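/- Let $r \geqslant 3$ be an integer, let $q = e^{2\pi i/r}$, and set $r' = r/\gcd(r,2)$, $r'' = r/\gcd(r,4)$, $\{n\} = q^n - q^{-n}$, $[n] = \{n\}/\{1\}$, $[n]! = [n][n-1]\cdots[1]$. Let $u_q\mathfrak{sl}_2$ be the $\mathbb{C}$-algebra with generators $K, K^{-1}, E, F$ and relations $$KK^{-1} = K^{-1}K = 1,\quad KEK^{-1} = q^2E,\quad KFK^{-1} = q^{-2}F,\quad EF - FE = \frac{K-K^{-1}}{q-q^{-1}},\quad K^{r'} = 1,\quad E^{r'} = F^{r'} = 0,$$ made into a Hopf algebra by $\Delta(K) = K \otimes K$, $\Delta(E) = E \otimes K + 1 \otimes E$, $\Delta(F) = F \otimes 1 + K^{-1} \otimes F$, $\varepsilon(K) = 1$, $\varepsilon(E) = \varepsilon(F) = 0$, $S(K) = K^{-1}$, $S(E) = -EK^{-1}$, $S(F) = -KF$. Consider its R-matrix $$R = \sum_i R'_i \otimes R''_i = \frac{1}{r'} \sum_{a,b,c=0}^{r'-1} \frac{\{1\}^a}{[a]!}\, q^{\frac{a(a-1)}{2}-2bc}\, K^bE^a \otimes K^cF^a,$$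 the Drinfeld element $u = \sum_i S(R''_i)R'_i$, the pivotal element $g = K$, and the ribbon element $v_+ = g^{-1}u$. Then $v_+$ is invertible, and $v_+$ and its inverse $v_-$ (which therefore satisfies $g = uv_-$) are given as follows. If $r \equiv 1 \bmod 2$, then $$v_+ = \frac{i^{\frac{r-1}{2}}}{\sqrt{r}} \sum_{a,b=0}^{r-1} \frac{\{-1\}^a}{[a]!}\, q^{-\frac{(a+3)a}{2}+\frac{r+1}{2}(b+1)^2} F^aE^aK^{-a+b},$$ $$v_- = \frac{i^{-\frac{r-1}{2}}}{\sqrt{r}} \sum_{a,b=0}^{r-1} \frac{\{1\}^a}{[a]!}\, q^{\frac{(a+3)a}{2}-\frac{r+1}{2}(b-1)^2} F^aE^aK^{a+b}.$$ If $r \equiv 2 \bmod 4$, then, with $\left(\frac{2}{r'}\right)$ the Jacobi symbol, $$v_+ = \left(\frac{2}{r'}\right) \frac{i^{\frac{r'-1}{2}}}{\sqrt{r'}} \sum_{a,b=0}^{r'-1} \frac{\{-1\}^a}{[a]!}\, q^{-\frac{(a+3)a}{2}+\frac{(r'+1)^2}{2}(b+1)^2} F^aE^aK^{-a+b},$$ $$v_-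 = \left(\frac{2}{r'}\right) \frac{i^{-\frac{r'-1}{2}}}{\sqrt{r'}} \sum_{a,b=0}^{r'-1} \frac{\{1\}^a}{[a]!}\, q^{\frac{(a+3)a}{2}-\frac{(r'+1)^2}{2}(b-1)^2} F^aE^aK^{a+b}.$$ If $r \equiv 4 \bmod 8$, then $$v_+ = \frac{i^{\frac{r''-1}{2}}}{\sqrt{r''}} \sum_{a=0}^{r'-1} \sum_{b=0}^{r''-1} \frac{\{-1\}^a}{[a]!}\, q^{-\frac{(a+3)a}{2}+\frac{(r''+1)^3}{2}(2b+1)^2} F^aE^aK^{-a+2b},$$ $$v_- = \frac{i^{-\frac{r''-1}{2}}}{\sqrt{r''}} \sum_{a=0}^{r'-1} \sum_{b=0}^{r''-1} \frac{\{1\}^a}{[a]!}\, q^{\frac{(a+3)a}{2}-\frac{(r''+1)^3}{2}(2b-1)^2} F^aE^aK^{a+2b}.$$ If $r \equiv 0 \bmod 8$, write $r = 2^k s$ with $k \geqslant 3$ and $s$ odd, and let $\psi \in \mathbb{N}$ be any number with $s\psi \equiv 1 \bmod 2^{k-1}$; then $$v_+ = \frac{1-i}{\sqrt{2}\sqrt{r''}}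 \sum_{a=0}^{r'-1} \sum_{b=0}^{s-1} \sum_{m=0}^{2^{k-2}-1} \frac{\{-1\}^a}{[a]!}\, q^{-\frac{(a+3)a}{2}+2(s\psi+(s+1)^{k+1})(2^{k-2}b+m)^2} F^aE^aK^{-a+2^{k-1}b+2m-1},$$ $$v_- = \frac{1+i}{\sqrt{2}\sqrt{r''}} \sum_{a=0}^{r'-1} \sum_{b=0}^{s-1} \sum_{m=0}^{2^{k-2}-1} \frac{\{1\}^a}{[a]!}\, q^{\frac{(a+3)a}{2}-2(s\psi+(s+1)^{k+1})(2^{k-2}b+m)^2} F^aE^aK^{a+2^{k-1}b+2m+1}.$$ -/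

import Mathlib

open scoped TensorProduct

noncomputable section

namespace SmallQuantum

/-! ### Quantum integers at a root of unity -/

/-- The root of unity `q = e^{2πi/r}`. -/
def q (r : ℕ) : ℂ := Complex.exp (2 * Real.pi * Complex.I / r)

/-- `r' = r / gcd(r, 2)`. -/
def r₁ (r : ℕ) : ℕ := r / Nat.gcd r 2

/-- `r'' = r / gcd(r, 4)`. -/
def r₂ (r : ℕ) : ℕ := r / Nat.gcd r 4

/-- The quantum bracket `{n} = q^n - q^{-n}`. -/
def brace (r : ℕ) (n : ℤ) : ℂ := q r ^ n - q r ^ (-n)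

/-- The quantum integer `[n] = {n} / {1}`. -/
def qInt (r : ℕ) (n : ℤ) : ℂ := brace r n / brace r 1

/-- The quantum factorial `[n]! = [n][n-1]⋯[1]`. -/
def qFact (r : ℕ) (n : ℕ) : ℂ := ∏ j ∈ Finset.range n, qInt r ((j : ℤ) + 1)

/-! ### The algebra -/

/-- The generators of `u_q sl₂`. -/
inductive Gen
  | K | Kinv | E | F

/-- The defining relations of `u_q sl₂`. -/
inductive Rel (r : ℕ) : FreeAlgebra ℂ Gen → FreeAlgebra ℂ Gen → Prop
  | K_Kinv : Rel r (FreeAlgebra.ι ℂ Gen.K * FreeAlgebra.ι ℂ Gen.Kinv) 1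
  | Kinv_K : Rel r (FreeAlgebra.ι ℂ Gen.Kinv * FreeAlgebra.ι ℂ Gen.K) 1
  | K_E : Rel r
      (FreeAlgebra.ι ℂ Gen.K * FreeAlgebra.ι ℂ Gen.E * FreeAlgebra.ι ℂ Gen.Kinv)
      (q r ^ (2 : ℤ) • FreeAlgebra.ι ℂ Gen.E)
  | K_F : Rel r
      (FreeAlgebra.ι ℂ Gen.K * FreeAlgebra.ι ℂ Gen.F * FreeAlgebra.ι ℂ Gen.Kinv)
      (q r ^ (-2 : ℤ) • FreeAlgebra.ι ℂ Gen.F)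
  | E_F : Rel r
      (FreeAlgebra.ι ℂ Gen.E * FreeAlgebra.ι ℂ Gen.F
        - FreeAlgebra.ι ℂ Gen.F * FreeAlgebra.ι ℂ Gen.E)
      ((q r - (q r)⁻¹)⁻¹ • (FreeAlgebra.ι ℂ Gen.K - FreeAlgebra.ι ℂ Gen.Kinv))
  | K_pow : Rel r (FreeAlgebra.ι ℂ Gen.K ^ r₁ r) 1
  | E_pow : Rel r (FreeAlgebra.ι ℂ Gen.E ^ r₁ r) 0
  | F_pow : Rel r (FreeAlgebra.ι ℂ Gen.F ^ r₁ r) 0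

end SmallQuantum

open SmallQuantum in
/-- The small quantum group `u_q sl₂` at `q = e^{2πi/r}`, by generators and relations. -/
def SmallQuantumSl2 (r : ℕ) : Type := RingQuot (Rel r)

namespace SmallQuantum

instance (r : ℕ) : Ring (SmallQuantumSl2 r) := inferInstanceAs (Ring (RingQuot (Rel r)))

instance (r : ℕ) : Algebra ℂ (SmallQuantumSl2 r) :=
  inferInstanceAs (Algebra ℂ (RingQuot (Rel r)))

/-- The image of a generator in `u_q sl₂`. -/
def gen (r : ℕ) (x : Gen) : SmallQuantumSl2 r :=
  RingQuot.mkAlgHom ℂ (Rel r) (FreeAlgebra.ι ℂ x)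

/-- The generator `E`. -/
def E (r : ℕ) : SmallQuantumSl2 r := gen r Gen.E

/-- The generator `F`. -/
def F (r : ℕ) : SmallQuantumSl2 r := gen r Gen.F

theorem gen_K_Kinv (r : ℕ) : gen r Gen.K * gen r Gen.Kinv = 1 := by
  simpa [gen] using! RingQuot.mkAlgHom_rel ℂ (Rel.K_Kinv (r := r))

theorem gen_Kinv_K (r : ℕ) : gen r Gen.Kinv * gen r Gen.K = 1 := by
  simpa [gen] using! RingQuot.mkAlgHom_rel ℂ (Rel.Kinv_K (r := r))

/-- The generator `K`, as a unit with inverse the generator `K⁻¹`. -/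
def K (r : ℕ) : (SmallQuantumSl2 r)ˣ :=
  ⟨gen r Gen.K, gen r Gen.Kinv, gen_K_Kinv r, gen_Kinv_K r⟩

theorem gen_K_E (r : ℕ) :
    gen r Gen.K * gen r Gen.E * gen r Gen.Kinv = q r ^ (2 : ℤ) • gen r Gen.E := by
  simpa [gen] using! RingQuot.mkAlgHom_rel ℂ (Rel.K_E (r := r))

theorem gen_K_F (r : ℕ) :
    gen r Gen.K * gen r Gen.F * gen r Gen.Kinv = q r ^ (-2 : ℤ) • gen r Gen.F := by
  simpa [gen] using! RingQuot.mkAlgHom_rel ℂ (Rel.K_F (r := r))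

theorem gen_E_F (r : ℕ) :
    gen r Gen.E * gen r Gen.F - gen r Gen.F * gen r Gen.E
      = (q r - (q r)⁻¹)⁻¹ • (gen r Gen.K - gen r Gen.Kinv) := by
  simpa [gen] using! RingQuot.mkAlgHom_rel ℂ (Rel.E_F (r := r))

theorem gen_K_pow (r : ℕ) : gen r Gen.K ^ r₁ r = 1 := by
  simpa [gen] using! RingQuot.mkAlgHom_rel ℂ (Rel.K_pow (r := r))

theorem gen_E_pow (r : ℕ) : gen r Gen.E ^ r₁ r = 0 := by
  simpa [gen] using! RingQuot.mkAlgHom_rel ℂ (Rel.E_pow (r := r))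

theorem gen_F_pow (r : ℕ) : gen r Gen.F ^ r₁ r = 0 := by
  simpa [gen] using! RingQuot.mkAlgHom_rel ℂ (Rel.F_pow (r := r))

/-- The universal property of `u_q sl₂`. -/
def lift (r : ℕ) {A : Type*} [Ring A] [Algebra ℂ A] (k k' e f : A)
    (h1 : k * k' = 1) (h2 : k' * k = 1)
    (h3 : k * e * k' = q r ^ (2 : ℤ) • e) (h4 : k * f * k' = q r ^ (-2 : ℤ) • f)
    (h5 : e * f - f * e = (q r - (q r)⁻¹)⁻¹ • (k - k'))
    (h6 : k ^ r₁ r = 1) (h7 : e ^ r₁ r = 0) (h8 : f ^ r₁ r = 0) :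
    SmallQuantumSl2 r →ₐ[ℂ] A :=
  RingQuot.liftAlgHom ℂ
    ⟨FreeAlgebra.lift ℂ fun
        | Gen.K => k
        | Gen.Kinv => k'
        | Gen.E => e
        | Gen.F => f,
      by
        intro x y h
        cases h
        case K_Kinv => simpa using h1
        case Kinv_K => simpa using h2
        case K_E => simpa using h3
        case K_F => simpa using h4
        case E_F => simpa using h5
        case K_pow => simpa using h6
        case E_pow => simpa using h7
        case F_pow => simpa using h8⟩

theorem lift_gen (r : ℕ) {A : Type*} [Ring A] [Algebra ℂ A] (k k' e f : A)
    (h1 : k * k' = 1) (h2 : k' * k = 1)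
    (h3 : k * e * k' = q r ^ (2 : ℤ) • e) (h4 : k * f * k' = q r ^ (-2 : ℤ) • f)
    (h5 : e * f - f * e = (q r - (q r)⁻¹)⁻¹ • (k - k'))
    (h6 : k ^ r₁ r = 1) (h7 : e ^ r₁ r = 0) (h8 : f ^ r₁ r = 0) :
    lift r k k' e f h1 h2 h3 h4 h5 h6 h7 h8 (gen r Gen.K) = k ∧
    lift r k k' e f h1 h2 h3 h4 h5 h6 h7 h8 (gen r Gen.Kinv) = k' ∧
    lift r k k' e f h1 h2 h3 h4 h5 h6 h7 h8 (gen r Gen.E) = e ∧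
    lift r k k' e f h1 h2 h3 h4 h5 h6 h7 h8 (gen r Gen.F) = f := by
  refine ⟨?_, ?_, ?_, ?_⟩ <;>
  · unfold lift gen
    erw [RingQuot.liftAlgHom_mkAlgHom_apply]
    simp

theorem hom_ext {r : ℕ} {A : Type*} [Semiring A] [Algebra ℂ A]
    {φ ψ : SmallQuantumSl2 r →ₐ[ℂ] A} (h : ∀ x, φ (gen r x) = ψ (gen r x)) : φ = ψ := by
  refine RingQuot.ringQuot_ext' (S := ℂ) (s := Rel r) φ ψ ?_
  ext x
  exact h x

theorem induction {r : ℕ} {P : SmallQuantumSl2 r → Prop}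
    (hC : ∀ c : ℂ, P (algebraMap ℂ _ c)) (hgen : ∀ x, P (gen r x))
    (hadd : ∀ x y, P x → P y → P (x + y)) (hmul : ∀ x y, P x → P y → P (x * y))
    (x : SmallQuantumSl2 r) : P x := by
  obtain ⟨y, rfl⟩ := RingQuot.mkAlgHom_surjective ℂ (Rel r) x
  induction y using FreeAlgebra.induction with
  | grade0 c =>
    exact (congrArg P (AlgHom.commutes (RingQuot.mkAlgHom ℂ (Rel r)) c)).mpr (hC c)
  | grade1 x => exact hgen x
  | mul a b ha hb => rw [map_mul]; exact hmul _ _ ha hb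
  | add a b ha hb => rw [map_add]; exact hadd _ _ ha hb

/-! ### Powers of sums and products of `q`-commuting elements -/

/-- Gaussian binomial coefficients. -/
def gauss (t : ℂ) : ℕ → ℕ → ℂ
  | _, 0 => 1
  | 0, _ + 1 => 0
  | m + 1, k + 1 => gauss t m k + t ^ (k + 1) * gauss t m (k + 1)

theorem gauss_mul (t : ℂ) (m k : ℕ) :
    gauss t m k * ∏ j ∈ Finset.range k, (1 - t ^ (j + 1))
      = ∏ j ∈ Finset.range k, (1 - t ^ (m - j)) := by
  induction m generalizing k with
  | zero =>
    cases k with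
    | zero => simp [gauss]
    | succ k => simp [gauss]
  | succ m ih =>
    cases k with
    | zero => simp [gauss]
    | succ k =>
      have h1 := ih k
      have h2 := ih (k + 1)
      rw [Finset.prod_range_succ, Finset.prod_range_succ] at h2
      rw [Finset.prod_range_succ, Finset.prod_range_succ']
      have h3 : ∏ j ∈ Finset.range k, (1 - t ^ (m + 1 - (j + 1)))
          = ∏ j ∈ Finset.range k, (1 - t ^ (m - j)) := by
        refine Finset.prod_congr rfl fun j _ => ?_
        rw [Nat.add_sub_add_right]
      rw [h3, gauss]
      rcases le_or_gt k m with hk | hk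
      · have h4 : t ^ (k + 1) * t ^ (m - k) = t ^ (m + 1) := by
          rw [← pow_add]; congr 1; omega
        rw [Nat.sub_zero]
        linear_combination (1 - t ^ (k + 1)) * h1 + t ^ (k + 1) * h2
          - (∏ j ∈ Finset.range k, (1 - t ^ (m - j))) * h4
      · have h4 : ∏ j ∈ Finset.range k, (1 - t ^ (m - j)) = 0 :=
          Finset.prod_eq_zero (Finset.mem_range.2 hk) (by simp)
        rw [h4] at h1 h2 ⊢
        linear_combination (1 - t ^ (k + 1)) * h1 + t ^ (k + 1) * h2

theorem gauss_eq_zero {t : ℂ} {n k : ℕ} (ht : IsPrimitiveRoot t n) (hk : 0 < k) (hkn : k < n) :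
    gauss t n k = 0 := by
  have h := gauss_mul t n k
  have h0 : ∏ j ∈ Finset.range k, (1 - t ^ (n - j)) = 0 :=
    Finset.prod_eq_zero (Finset.mem_range.2 hk) (by simp [ht.pow_eq_one])
  rw [h0] at h
  refine (mul_eq_zero.1 h).resolve_right (Finset.prod_ne_zero_iff.2 fun j hj => ?_)
  have hj' := Finset.mem_range.1 hj
  rw [sub_ne_zero]
  exact (ht.pow_ne_one_of_pos_of_lt (by omega) (by omega)).symm

theorem gauss_succ_self (t : ℂ) (m k : ℕ) (h : m < k) : gauss t m k = 0 := by
  induction m generalizing k with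
  | zero => cases k with
    | zero => omega
    | succ k => rfl
  | succ m ih => cases k with
    | zero => omega
    | succ k => rw [gauss, ih k (by omega), ih (k + 1) (by omega)]; simp

section

variable {A : Type*} [Ring A] [Algebra ℂ A]

theorem y_mul_x_pow {x y : A} {t : ℂ} (h : y * x = t • (x * y)) (k : ℕ) :
    y * x ^ k = t ^ k • (x ^ k * y) := by
  induction k with
  | zero => simp
  | succ k ih =>
    rw [pow_succ, ← mul_assoc, ih, smul_mul_assoc, mul_assoc, h, mul_smul_comm, smul_smul,
      pow_succ, mul_assoc]

theorem add_pow_gauss {x y : A} {t : ℂ} (h : y * x = t • (x * y)) (m : ℕ) :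
    (x + y) ^ m = ∑ k ∈ Finset.range (m + 1), gauss t m k • (x ^ k * y ^ (m - k)) := by
  induction m with
  | zero => simp [gauss]
  | succ m ih =>
    have e1 : x * (x + y) ^ m
        = ∑ k ∈ Finset.range (m + 1), gauss t m k • (x ^ (k + 1) * y ^ (m - k)) := by
      rw [ih, Finset.mul_sum]
      refine Finset.sum_congr rfl fun k _ => ?_
      rw [mul_smul_comm, ← mul_assoc, pow_succ' x]
    have e2 : y * (x + y) ^ m
        = ∑ k ∈ Finset.range (m + 1), (t ^ k * gauss t m k) • (x ^ k * y ^ (m + 1 - k)) := by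
      rw [ih, Finset.mul_sum]
      refine Finset.sum_congr rfl fun k hk => ?_
      have hk' := Finset.mem_range.1 hk
      rw [mul_smul_comm, ← mul_assoc, y_mul_x_pow h, smul_mul_assoc, smul_smul, mul_assoc,
        ← pow_succ' y, mul_comm (gauss t m k)]
      congr 4
      omega
    have e3 : y * (x + y) ^ m
        = y ^ (m + 1) + ∑ k ∈ Finset.range (m + 1),
            (t ^ (k + 1) * gauss t m (k + 1)) • (x ^ (k + 1) * y ^ (m - k)) := by
      rw [e2, Finset.sum_range_succ' _ m, Finset.sum_range_succ _ m,
        gauss_succ_self t m (m + 1) (by omega), add_comm]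
      simp [gauss]
    rw [pow_succ', add_mul, e1, e3, Finset.sum_range_succ' _ (m + 1)]
    simp only [gauss, add_smul, Finset.sum_add_distrib, Nat.add_sub_add_right]
    simp only [pow_zero, one_smul, one_mul, Nat.sub_zero]
    abel

theorem add_pow_eq_zero {x y : A} {t : ℂ} {n : ℕ} (ht : IsPrimitiveRoot t n)
    (h : y * x = t • (x * y)) (hx : x ^ n = 0) (hy : y ^ n = 0) : (x + y) ^ n = 0 := by
  rw [add_pow_gauss h]
  refine Finset.sum_eq_zero fun k hk => ?_
  have hk' := Finset.mem_range.1 hk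
  rcases Nat.eq_zero_or_pos k with rfl | h0
  · simp [hy]
  · rcases Nat.lt_or_ge k n with h1 | h1
    · rw [gauss_eq_zero ht h0 h1, zero_smul]
    · obtain rfl : k = n := by omega
      simp [hx]

theorem mul_pow_eq_zero {x y : A} {t : ℂ} {n : ℕ}
    (h : y * x = t • (x * y)) (hx : x ^ n = 0) : (x * y) ^ n = 0 := by
  have key : ∀ m : ℕ, ∃ c : ℂ, (x * y) ^ m = c • (x ^ m * y ^ m) := by
    intro m
    induction m with
    | zero => exact ⟨1, by simp⟩
    | succ m ih =>
      obtain ⟨c, hc⟩ := ih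
      refine ⟨c * t ^ m, ?_⟩
      rw [pow_succ', hc, mul_smul_comm, mul_assoc x y, ← mul_assoc y, y_mul_x_pow h,
        smul_mul_assoc, mul_smul_comm, smul_smul, mul_assoc, ← pow_succ' y, ← mul_assoc x,
        ← pow_succ' x]
  obtain ⟨c, hc⟩ := key n
  rw [hc, hx, zero_mul, smul_zero]

end

/-! ### The Hopf algebra structure -/

section

variable {A : Type*} [Ring A] [Algebra ℂ A]

theorem conj_left {k k' x : A} {s : ℂ} (h : k' * k = 1) (hx : k * x * k' = s • x) :
    k * x = s • (x * k) := by
  rw [← smul_mul_assoc, ← hx, mul_assoc, h, mul_one]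

theorem conj_right {k k' x : A} {s : ℂ} (h : k' * k = 1) (hx : k * x * k' = s • x) :
    x * k' = s • (k' * x) := by
  rw [← mul_smul_comm, ← hx, mul_assoc k, ← mul_assoc k', h, one_mul]

end

theorem q_ne_zero (r : ℕ) : q r ≠ 0 := Complex.exp_ne_zero _

theorem r₁_pos (r : ℕ) [h : Fact (2 < r)] : 0 < r₁ r :=
  Nat.div_pos (Nat.gcd_le_left _ (by have := h.out; omega)) (Nat.gcd_pos_of_pos_right _ two_pos)

theorem q_sq_primitive (r : ℕ) [h : Fact (2 < r)] :
    IsPrimitiveRoot (q r ^ (2 : ℤ)) (r₁ r) := by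
  have hr := h.out
  have hq : IsPrimitiveRoot (q r) r := Complex.isPrimitiveRoot_exp r (by omega)
  rw [show q r ^ (2 : ℤ) = q r ^ 2 from zpow_natCast (q r) 2]
  unfold r₁
  rcases Nat.even_or_odd' r with ⟨m, hm | hm⟩
  · have : Nat.gcd r 2 = 2 := Nat.gcd_eq_right (by omega)
    rw [this]
    exact hq.pow (by omega) (by omega)
  · have h2 : Nat.Coprime 2 r := by
      rw [Nat.coprime_two_left]; exact ⟨m, hm⟩
    have : Nat.gcd r 2 = 1 := h2.symm
    rw [this, Nat.div_one]
    exact hq.pow_of_coprime 2 h2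

theorem K_mul_E (r : ℕ) : gen r Gen.K * gen r Gen.E = q r ^ (2 : ℤ) • (gen r Gen.E * gen r Gen.K) :=
  conj_left (gen_Kinv_K r) (gen_K_E r)

theorem E_mul_Kinv (r : ℕ) :
    gen r Gen.E * gen r Gen.Kinv = q r ^ (2 : ℤ) • (gen r Gen.Kinv * gen r Gen.E) :=
  conj_right (gen_Kinv_K r) (gen_K_E r)

theorem K_mul_F (r : ℕ) :
    gen r Gen.K * gen r Gen.F = q r ^ (-2 : ℤ) • (gen r Gen.F * gen r Gen.K) :=
  conj_left (gen_Kinv_K r) (gen_K_F r)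

theorem Kinv_mul_F (r : ℕ) :
    gen r Gen.Kinv * gen r Gen.F = q r ^ (2 : ℤ) • (gen r Gen.F * gen r Gen.Kinv) := by
  rw [conj_right (gen_Kinv_K r) (gen_K_F r), smul_smul, ← zpow_add₀ (q_ne_zero r)]
  simp

theorem E_mul_F (r : ℕ) :
    gen r Gen.E * gen r Gen.F = gen r Gen.F * gen r Gen.E
      + (q r - (q r)⁻¹)⁻¹ • (gen r Gen.K - gen r Gen.Kinv) := by
  rw [← gen_E_F]; abel

/-- The coproduct: `Δ(K) = K ⊗ K`, `Δ(E) = E ⊗ K + 1 ⊗ E`, `Δ(F) = F ⊗ 1 + K⁻¹ ⊗ F`. -/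
def comulHom (r : ℕ) [Fact (2 < r)] :
    SmallQuantumSl2 r →ₐ[ℂ] SmallQuantumSl2 r ⊗[ℂ] SmallQuantumSl2 r :=
  lift r (gen r Gen.K ⊗ₜ gen r Gen.K) (gen r Gen.Kinv ⊗ₜ gen r Gen.Kinv)
    (gen r Gen.E ⊗ₜ gen r Gen.K + 1 ⊗ₜ gen r Gen.E)
    (gen r Gen.F ⊗ₜ 1 + gen r Gen.Kinv ⊗ₜ gen r Gen.F)
    (by simp [gen_K_Kinv, Algebra.TensorProduct.one_def])
    (by simp [gen_Kinv_K, Algebra.TensorProduct.one_def])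
    (by
      simp only [mul_add, add_mul, Algebra.TensorProduct.tmul_mul_tmul, gen_K_E, mul_one,
        gen_K_Kinv, smul_add]
      rw [mul_assoc (gen r Gen.K) (gen r Gen.K), gen_K_Kinv, mul_one,
        TensorProduct.smul_tmul', TensorProduct.tmul_smul])
    (by
      simp only [mul_add, add_mul, Algebra.TensorProduct.tmul_mul_tmul, gen_K_F, mul_one,
        gen_K_Kinv, one_mul, smul_add]
      rw [TensorProduct.smul_tmul', TensorProduct.tmul_smul])
    (by
      simp only [mul_add, add_mul, Algebra.TensorProduct.tmul_mul_tmul, mul_one, one_mul]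
      have h : (gen r Gen.E * gen r Gen.Kinv) ⊗ₜ[ℂ] (gen r Gen.K * gen r Gen.F)
          = (gen r Gen.Kinv * gen r Gen.E) ⊗ₜ[ℂ] (gen r Gen.F * gen r Gen.K) := by
        rw [E_mul_Kinv, K_mul_F, TensorProduct.tmul_smul, ← TensorProduct.smul_tmul', smul_smul,
          ← zpow_add₀ (q_ne_zero r)]
        simp
      rw [h, E_mul_F]
      simp only [TensorProduct.add_tmul, TensorProduct.tmul_add, TensorProduct.tmul_smul,
        ← TensorProduct.smul_tmul', TensorProduct.tmul_sub, TensorProduct.sub_tmul, smul_sub]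
      abel)
    (by
      rw [Algebra.TensorProduct.tmul_pow, gen_K_pow, Algebra.TensorProduct.one_def])
    (by
      rw [add_comm]
      refine add_pow_eq_zero (q_sq_primitive r) ?_ ?_ ?_
      · simp only [Algebra.TensorProduct.tmul_mul_tmul, mul_one, one_mul, K_mul_E,
          TensorProduct.tmul_smul]
      · rw [Algebra.TensorProduct.tmul_pow, gen_E_pow, TensorProduct.tmul_zero]
      · rw [Algebra.TensorProduct.tmul_pow, gen_E_pow, TensorProduct.zero_tmul])
    (by
      refine add_pow_eq_zero (q_sq_primitive r) ?_ ?_ ?_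
      · simp only [Algebra.TensorProduct.tmul_mul_tmul, mul_one, one_mul, Kinv_mul_F,
          TensorProduct.smul_tmul']
      · rw [Algebra.TensorProduct.tmul_pow, gen_F_pow, TensorProduct.zero_tmul]
      · rw [Algebra.TensorProduct.tmul_pow, gen_F_pow, TensorProduct.tmul_zero])

/-- The counit: `ε(K) = 1`, `ε(E) = ε(F) = 0`. -/
def counitHom (r : ℕ) [Fact (2 < r)] : SmallQuantumSl2 r →ₐ[ℂ] ℂ :=
  lift r 1 1 0 0 (by simp) (by simp) (by simp) (by simp) (by simp) (by simp)
    (zero_pow (r₁_pos r).ne') (zero_pow (r₁_pos r).ne')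

/-- The antipode, as an algebra map to the opposite algebra:
`S(K) = K⁻¹`, `S(E) = -E K⁻¹`, `S(F) = -K F`. -/
def antipodeHom (r : ℕ) : SmallQuantumSl2 r →ₐ[ℂ] (SmallQuantumSl2 r)ᵐᵒᵖ :=
  lift r (MulOpposite.op (gen r Gen.Kinv)) (MulOpposite.op (gen r Gen.K))
    (MulOpposite.op (-(gen r Gen.E * gen r Gen.Kinv)))
    (MulOpposite.op (-(gen r Gen.K * gen r Gen.F)))
    (by rw [← MulOpposite.op_mul, gen_K_Kinv, MulOpposite.op_one])
    (by rw [← MulOpposite.op_mul, gen_Kinv_K, MulOpposite.op_one])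
    (by
      rw [← MulOpposite.op_mul, ← MulOpposite.op_mul, ← MulOpposite.op_smul]
      congr 1
      rw [neg_mul, mul_neg, ← mul_assoc, ← mul_assoc, gen_K_E, smul_mul_assoc, smul_neg])
    (by
      rw [← MulOpposite.op_mul, ← MulOpposite.op_mul, ← MulOpposite.op_smul]
      congr 1
      rw [neg_mul, mul_neg, mul_assoc (gen r Gen.K) (gen r Gen.F),
        ← mul_assoc (gen r Gen.K) (gen r Gen.F), gen_K_F, mul_smul_comm, smul_neg])
    (by
      rw [← MulOpposite.op_mul, ← MulOpposite.op_mul, ← MulOpposite.op_sub,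
        ← MulOpposite.op_sub, ← MulOpposite.op_smul]
      congr 1
      have h1 : gen r Gen.K * gen r Gen.F * (gen r Gen.E * gen r Gen.Kinv)
          = gen r Gen.F * gen r Gen.E := by
        rw [K_mul_F, E_mul_Kinv, smul_mul_smul_comm, ← zpow_add₀ (q_ne_zero r), mul_assoc,
          ← mul_assoc (gen r Gen.K), gen_K_Kinv]
        simp
      have h2 : gen r Gen.E * gen r Gen.Kinv * (gen r Gen.K * gen r Gen.F)
          = gen r Gen.E * gen r Gen.F := by
        rw [mul_assoc, ← mul_assoc (gen r Gen.Kinv), gen_Kinv_K, one_mul]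
      rw [neg_mul_neg, neg_mul_neg, h1, h2, E_mul_F, ← neg_sub (gen r Gen.K), smul_neg]
      abel)
    (by
      have h : gen r Gen.Kinv ^ r₁ r = 1 := by
        have h1 : (K r) ^ r₁ r = 1 := Units.ext (by simpa [K] using gen_K_pow r)
        have h2 : ((K r)⁻¹) ^ r₁ r = 1 := by rw [inv_pow, h1, inv_one]
        simpa [K] using congrArg Units.val h2
      rw [← MulOpposite.op_pow, h, MulOpposite.op_one])
    (by
      have h : gen r Gen.Kinv * gen r Gen.E
          = q r ^ (-2 : ℤ) • (gen r Gen.E * gen r Gen.Kinv) := by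
        rw [E_mul_Kinv, smul_smul, ← zpow_add₀ (q_ne_zero r)]
        simp
      rw [← MulOpposite.op_pow, neg_pow, mul_pow_eq_zero h (gen_E_pow r), mul_zero,
        MulOpposite.op_zero])
    (by
      have h : gen r Gen.K * gen r Gen.F = q r ^ (-2 : ℤ) • (gen r Gen.F * gen r Gen.K) :=
        K_mul_F r
      rw [← MulOpposite.op_pow, neg_pow, h, smul_pow, mul_pow_eq_zero h (gen_F_pow r), smul_zero,
        mul_zero, MulOpposite.op_zero])

theorem comulHom_gen (r : ℕ) [Fact (2 < r)] :
    comulHom r (gen r Gen.K) = gen r Gen.K ⊗ₜ gen r Gen.K ∧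
    comulHom r (gen r Gen.Kinv) = gen r Gen.Kinv ⊗ₜ gen r Gen.Kinv ∧
    comulHom r (gen r Gen.E) = gen r Gen.E ⊗ₜ gen r Gen.K + 1 ⊗ₜ gen r Gen.E ∧
    comulHom r (gen r Gen.F) = gen r Gen.F ⊗ₜ 1 + gen r Gen.Kinv ⊗ₜ gen r Gen.F :=
  lift_gen ..

theorem counitHom_gen (r : ℕ) [Fact (2 < r)] :
    counitHom r (gen r Gen.K) = 1 ∧ counitHom r (gen r Gen.Kinv) = 1 ∧
    counitHom r (gen r Gen.E) = 0 ∧ counitHom r (gen r Gen.F) = 0 :=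
  lift_gen ..

theorem antipodeHom_gen (r : ℕ) :
    antipodeHom r (gen r Gen.K) = MulOpposite.op (gen r Gen.Kinv) ∧
    antipodeHom r (gen r Gen.Kinv) = MulOpposite.op (gen r Gen.K) ∧
    antipodeHom r (gen r Gen.E) = MulOpposite.op (-(gen r Gen.E * gen r Gen.Kinv)) ∧
    antipodeHom r (gen r Gen.F) = MulOpposite.op (-(gen r Gen.K * gen r Gen.F)) :=
  lift_gen ..

instance (r : ℕ) [Fact (2 < r)] : Bialgebra ℂ (SmallQuantumSl2 r) :=
  Bialgebra.ofAlgHom (comulHom r) (counitHom r)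
    (by
      obtain ⟨h1, h2, h3, h4⟩ := comulHom_gen r
      refine hom_ext fun x => ?_
      cases x <;>
        simp [h1, h2, h3, h4, TensorProduct.add_tmul, TensorProduct.tmul_add,
          Algebra.TensorProduct.one_def, add_assoc])
    (by
      obtain ⟨h1, h2, h3, h4⟩ := comulHom_gen r
      obtain ⟨c1, c2, c3, c4⟩ := counitHom_gen r
      refine hom_ext fun x => ?_
      cases x <;> simp [h1, h2, h3, h4, c1, c2, c3, c4])
    (by
      obtain ⟨h1, h2, h3, h4⟩ := comulHom_gen r
      obtain ⟨c1, c2, c3, c4⟩ := counitHom_gen r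
      refine hom_ext fun x => ?_
      cases x <;> simp [h1, h2, h3, h4, c1, c2, c3, c4])

/-- The antipode as a linear endomorphism. -/
def antipodeLin (r : ℕ) : SmallQuantumSl2 r →ₗ[ℂ] SmallQuantumSl2 r :=
  (MulOpposite.opLinearEquiv ℂ).symm.toLinearMap ∘ₗ (antipodeHom r).toLinearMap

theorem antipodeLin_mul (r : ℕ) (x y : SmallQuantumSl2 r) :
    antipodeLin r (x * y) = antipodeLin r y * antipodeLin r x := by
  simp [antipodeLin]

theorem antipodeLin_algebraMap (r : ℕ) (c : ℂ) :
    antipodeLin r (algebraMap ℂ _ c) = algebraMap ℂ _ c := by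
  simp [antipodeLin]

theorem antipodeLin_one (r : ℕ) : antipodeLin r 1 = 1 := by
  simp [antipodeLin]

theorem antipodeLin_gen (r : ℕ) :
    antipodeLin r (gen r Gen.K) = gen r Gen.Kinv ∧
    antipodeLin r (gen r Gen.Kinv) = gen r Gen.K ∧
    antipodeLin r (gen r Gen.E) = -(gen r Gen.E * gen r Gen.Kinv) ∧
    antipodeLin r (gen r Gen.F) = -(gen r Gen.K * gen r Gen.F) := by
  obtain ⟨h1, h2, h3, h4⟩ := antipodeHom_gen r
  simp [antipodeLin, h1, h2, h3, h4]

theorem antipode_left_mul (r : ℕ) (a b : SmallQuantumSl2 r ⊗[ℂ] SmallQuantumSl2 r) (c : ℂ)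
    (ha : LinearMap.mul' ℂ _ ((antipodeLin r).rTensor _ a) = algebraMap ℂ _ c) :
    LinearMap.mul' ℂ _ ((antipodeLin r).rTensor _ (a * b))
      = algebraMap ℂ _ c * LinearMap.mul' ℂ _ ((antipodeLin r).rTensor _ b) := by
  induction b with
  | zero => simp
  | add b b' hb hb' => simp only [mul_add, map_add, hb, hb']
  | tmul y z =>
    have : LinearMap.mul' ℂ _ ((antipodeLin r).rTensor _ (a * (y ⊗ₜ[ℂ] z)))
        = antipodeLin r y * LinearMap.mul' ℂ _ ((antipodeLin r).rTensor _ a) * z := by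
      clear ha
      induction a with
      | zero => simp
      | add a a' h h' => simp only [add_mul, mul_add, map_add, h, h']
      | tmul s t => simp [antipodeLin_mul, mul_assoc]
    rw [this, ha, ← Algebra.commutes, mul_assoc]
    simp

theorem antipode_right_mul (r : ℕ) (a b : SmallQuantumSl2 r ⊗[ℂ] SmallQuantumSl2 r) (c : ℂ)
    (hb : LinearMap.mul' ℂ _ ((antipodeLin r).lTensor _ b) = algebraMap ℂ _ c) :
    LinearMap.mul' ℂ _ ((antipodeLin r).lTensor _ (a * b))
      = LinearMap.mul' ℂ _ ((antipodeLin r).lTensor _ a) * algebraMap ℂ _ c := by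
  induction a with
  | zero => simp
  | add a a' h h' => simp only [add_mul, map_add, h, h']
  | tmul y z =>
    have : LinearMap.mul' ℂ _ ((antipodeLin r).lTensor _ ((y ⊗ₜ[ℂ] z) * b))
        = y * LinearMap.mul' ℂ _ ((antipodeLin r).lTensor _ b) * antipodeLin r z := by
      clear hb
      induction b with
      | zero => simp
      | add a a' h h' => simp only [add_mul, mul_add, map_add, h, h']
      | tmul s t => simp [antipodeLin_mul, mul_assoc]
    rw [this, hb, mul_assoc, Algebra.commutes, ← mul_assoc]
    simp

instance (r : ℕ) [Fact (2 < r)] : HopfAlgebra ℂ (SmallQuantumSl2 r) where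
  antipode := antipodeLin r
  mul_antipode_rTensor_comul := by
    refine LinearMap.ext fun x => ?_
    change LinearMap.mul' ℂ _ ((antipodeLin r).rTensor _ (comulHom r x))
      = algebraMap ℂ _ (counitHom r x)
    obtain ⟨h1, h2, h3, h4⟩ := comulHom_gen r
    obtain ⟨c1, c2, c3, c4⟩ := counitHom_gen r
    obtain ⟨s1, s2, s3, s4⟩ := antipodeLin_gen r
    induction x using SmallQuantum.induction with
    | hC c => simp [Algebra.TensorProduct.algebraMap_apply, antipodeLin_algebraMap]
    | hadd x y hx hy => simp only [map_add, hx, hy]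
    | hmul x y hx hy => rw [map_mul, antipode_left_mul r _ _ _ hx, hy, map_mul, map_mul]
    | hgen x =>
      cases x
      · simp [h1, c1, s1, gen_Kinv_K]
      · simp [h2, c2, s2, gen_K_Kinv]
      · simp [h3, c3, s3, antipodeLin_one, mul_assoc, gen_Kinv_K]
      · simp [h4, c4, s4, s2]
  mul_antipode_lTensor_comul := by
    refine LinearMap.ext fun x => ?_
    change LinearMap.mul' ℂ _ ((antipodeLin r).lTensor _ (comulHom r x))
      = algebraMap ℂ _ (counitHom r x)
    obtain ⟨h1, h2, h3, h4⟩ := comulHom_gen r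
    obtain ⟨c1, c2, c3, c4⟩ := counitHom_gen r
    obtain ⟨s1, s2, s3, s4⟩ := antipodeLin_gen r
    induction x using SmallQuantum.induction with
    | hC c => simp [Algebra.TensorProduct.algebraMap_apply, antipodeLin_one]
    | hadd x y hx hy => simp only [map_add, hx, hy]
    | hmul x y hx hy => rw [map_mul, antipode_right_mul r _ _ _ hy, hx, map_mul, map_mul]
    | hgen x =>
      cases x
      · simp [h1, c1, s1, gen_K_Kinv]
      · simp [h2, c2, s2, gen_Kinv_K]
      · simp [h3, c3, s3, s1]
      · simp [h4, c4, s4, antipodeLin_one, ← mul_assoc, gen_Kinv_K]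

/-! ### R-matrix, Drinfeld element and ribbon element -/

/-- The Drinfeld element `u = S(R''ᵢ) R'ᵢ` of `R = R'ᵢ ⊗ R''ᵢ` in a Hopf algebra. -/
def drinfeldElement {H : Type*} [Ring H] [HopfAlgebra ℂ H] (R : H ⊗[ℂ] H) : H :=
  LinearMap.mul' ℂ H ((HopfAlgebra.antipode ℂ).rTensor H (TensorProduct.comm ℂ H H R))

/-- The R-matrix of `u_q sl₂`. -/
def rMatrix (r : ℕ) : SmallQuantumSl2 r ⊗[ℂ] SmallQuantumSl2 r :=
  (1 / (r₁ r : ℂ)) •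
    ∑ a ∈ Finset.range (r₁ r), ∑ b ∈ Finset.range (r₁ r), ∑ c ∈ Finset.range (r₁ r),
      (brace r 1 ^ a / qFact r a * q r ^ (((a : ℤ) * (a - 1)) / 2 - 2 * b * c)) •
        (((K r ^ b : (SmallQuantumSl2 r)ˣ) * E r ^ a) ⊗ₜ[ℂ]
          ((K r ^ c : (SmallQuantumSl2 r)ˣ) * F r ^ a))

/-- The pivotal element `g = K` of `u_q sl₂`. -/
def pivotal (r : ℕ) : (SmallQuantumSl2 r)ˣ := K r

/-- The ribbon element `v₊` of `u_q sl₂`: with `u` the Drinfeld element of the R-matrix, it is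
determined by the compatibility `g = u v₊⁻¹` with the pivotal element, that is, `v₊ = g⁻¹ u`. -/
def ribbonElement (r : ℕ) [Fact (2 < r)] : SmallQuantumSl2 r :=
  ((pivotal r)⁻¹ : (SmallQuantumSl2 r)ˣ) * drinfeldElement (rMatrix r)

end SmallQuantum

end

/-! ### Quadratic Gauss sums -/

namespace GaussSum

open Complex Filter Topology

/-! Write `G n` for `gaussian r n`, the element acting by `q^(2nc²)` where `K` acts by `q^(2c)`.
Applying `S(R'')R'` to the Cartan part of the R-matrix gives `(1/r') Σ q^(-2bc) K^(b-c)`, which is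
exactly `G (-1)`. Hence `v₊ = Σ_a coeffPos a · F^a E^a K^(-a-1) G(-1)` (`ribbonElement_eq`), and the
proposed inverse is the mirror series `Σ_a coeffNeg a · F^a E^a K^(a+1) G(1)`.

That these are inverse to each other rests on centrality. The element `v₊` commutes with `E` and `F`
because the corrections produced by the commutators `[E^(a+1), F]` and `[E, F^(a+1)]` telescope, the
last terms being killed by `E^r' = F^r' = 0`. Once `v₊` is central, it can be inserted between `F^a`
and `E^a` in each term of the proposed inverse. The product then becomes a combination of `F^n E^n
K^(-n)` without any reordering of `E` and `F`, and for `0 < n < r'` the coefficients vanish by an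
alternating q-binomial identity (`sum_antidiagonal_qFact`).

There remains the expansion of `G (±1)` in powers of `K`. Its Fourier coefficients are quadratic
exponential sums, and completing the square turns each into a fixed Gauss sum times a Gaussian in
the exponent of `K`. For odd `r'` this requires an inverse of 2 modulo `r'`. For even `r'` half of
the coefficients vanish under a half-period shift, and those that survive are at odd exponents when
`r ≡ 4 mod 8` and at even ones when `8 ∣ r`. This is the origin of the case distinction. The
constants in front come from the values of Gauss sums, sign included, which follow from the
Landsberg–Schaar reciprocity `landsberg_schaar` with `m = 1` and `m = 2`. That reciprocity is in
turn the asymptotics of the theta function at a rational boundary point. -/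

theorem ofReal_mul_cpow {x : ℝ} (hx : 0 < x) {z : ℂ} (hz : z ≠ 0) (s : ℂ) :
    ((x : ℂ) * z) ^ s = (x : ℂ) ^ s * z ^ s := by
  have hx' : (x : ℂ) ≠ 0 := ofReal_ne_zero.2 hx.ne'
  rw [cpow_def_of_ne_zero (mul_ne_zero hx' hz), cpow_def_of_ne_zero hx', cpow_def_of_ne_zero hz,
    log_ofReal_mul hx hz, ← Complex.exp_add, ofReal_log hx.le, add_mul]

theorem ofReal_sq_cpow_half {x : ℝ} (hx : 0 < x) : ((x ^ 2 : ℝ) : ℂ) ^ (1 / 2 : ℂ) = x := by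
  rw [show (1 / 2 : ℂ) = ((1 / 2 : ℝ) : ℂ) by push_cast; ring, ← ofReal_cpow (sq_nonneg x),
    ← Real.sqrt_eq_rpow, Real.sqrt_sq hx.le]

theorem summable_exp_neg_mul_sq {s : ℂ} (hs : 0 < s.re) :
    Summable fun n : ℤ => cexp (-Real.pi * s * n ^ 2) := by
  have h := (summable_jacobiTheta₂_term_iff 0 (I * s)).2 (by simpa using hs)
  refine h.congr fun n => ?_
  rw [jacobiTheta₂_term]
  congr 1
  linear_combination (Real.pi * s * n ^ 2 : ℂ) * I_sq

theorem norm_exp_neg_mul_sq (s : ℂ) (x : ℝ) (n : ℤ) :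
    ‖cexp (-Real.pi * s * n ^ 2 + 2 * Real.pi * I * n * x)‖ = Real.exp (-Real.pi * s.re * n ^ 2) := by
  have h1 : (2 * Real.pi * I * n * x : ℂ) = ((2 * Real.pi * n * x : ℝ) : ℂ) * I := by
    push_cast; ring
  have h2 : (-Real.pi * s * n ^ 2 : ℂ) = ((-Real.pi * n ^ 2 : ℝ) : ℂ) * s := by
    push_cast; ring
  rw [Complex.exp_add, norm_mul, h1, norm_exp_ofReal_mul_I, mul_one, norm_exp, h2, re_ofReal_mul]
  congr 1
  ring

/-- Only the term `n = 0` survives as `Re s → ∞`; once `Re s ≥ 1` the terms are dominated by `exp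
(-π n²)`. The phase `x` is there because Poisson summation over a residue class produces one. -/
theorem tendsto_tsum_exp_neg_mul_sq {ι : Type*} {l : Filter ι} {s : ι → ℂ}
    (hs : Tendsto (fun i => (s i).re) l atTop) (x : ℝ) :
    Tendsto (fun i => ∑' n : ℤ, cexp (-Real.pi * s i * n ^ 2 + 2 * Real.pi * I * n * x))
      l (𝓝 1) := by
  have hsum : Summable fun n : ℤ => Real.exp (-Real.pi * n ^ 2) := by
    have h := (summable_exp_neg_mul_sq (s := 1) (by simp)).norm
    refine h.congr fun n => ?_
    have := norm_exp_neg_mul_sq 1 0 n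
    simpa using this
  have key := tendsto_tsum_of_dominated_convergence (𝓕 := l)
    (f := fun i (n : ℤ) => cexp (-Real.pi * s i * n ^ 2 + 2 * Real.pi * I * n * x))
    (g := fun n : ℤ => if n = 0 then (1 : ℂ) else 0) hsum ?_ ?_
  · simpa using key
  · intro n
    split_ifs with hn
    · simpa [hn] using tendsto_const_nhds
    · rw [tendsto_zero_iff_norm_tendsto_zero]
      simp only [norm_exp_neg_mul_sq]
      refine Real.tendsto_exp_atBot.comp ?_
      have hn' : (0 : ℝ) < n ^ 2 := by positivity
      have h1 : -Real.pi * (n : ℝ) ^ 2 < 0 := by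
        have := mul_pos Real.pi_pos hn'
        linarith
      refine (hs.const_mul_atTop_of_neg h1).congr fun i => ?_
      ring
  · filter_upwards [hs.eventually_ge_atTop 1] with i hi n
    rw [norm_exp_neg_mul_sq]
    refine Real.exp_le_exp.2 ?_
    have : 0 ≤ Real.pi * (n : ℝ) ^ 2 := by positivity
    nlinarith

/-- Poisson summation on the progression `j + pℤ`: the offset `j` becomes the phase `j / p` of the
dual series. -/
theorem tsum_exp_neg_mul_progression {ε : ℂ} (hε : 0 < ε.re) {p : ℕ} (hp : 0 < p) (j : ℕ) :
    ε ^ (1 / 2 : ℂ) * ∑' m : ℤ, cexp (-Real.pi * ε * (m * p + j) ^ 2) =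
      1 / p * ∑' n : ℤ, cexp (-Real.pi * (1 / (p ^ 2 * ε)) * n ^ 2
        + 2 * Real.pi * I * n * ((j / p : ℝ) : ℝ)) := by
  have hε0 : ε ≠ 0 := by rintro rfl; simp at hε
  have hp0 : (p : ℂ) ≠ 0 := by exact_mod_cast hp.ne'
  have hpr : (0 : ℝ) < p := by exact_mod_cast hp
  have ha : 0 < (((p ^ 2 : ℝ) : ℂ) * ε).re := by
    rw [re_ofReal_mul]; positivity
  -- The linear coefficient is the cross term of `ε (m p + j)²`.
  have h := Complex.tsum_exp_neg_quadratic ha (-(ε * p * j))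
  have h1 : ∀ m : ℤ, cexp (-Real.pi * ε * (m * p + j) ^ 2) =
      cexp (-Real.pi * ε * j ^ 2) * cexp (-Real.pi * (((p ^ 2 : ℝ) : ℂ) * ε) * m ^ 2
        + 2 * Real.pi * (-(ε * p * j)) * m) := by
    intro m
    rw [← Complex.exp_add]
    congr 1
    push_cast
    ring
  have h2 : ∀ n : ℤ, cexp (-Real.pi * ε * j ^ 2) *
      cexp (-Real.pi / (((p ^ 2 : ℝ) : ℂ) * ε) * (n + I * (-(ε * p * j))) ^ 2) =
      cexp (-Real.pi * (1 / (p ^ 2 * ε)) * n ^ 2 + 2 * Real.pi * I * n * ((j / p : ℝ) : ℝ)) := by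
    intro n
    rw [← Complex.exp_add]
    congr 1
    push_cast
    field_simp
    ring_nf
    rw [I_sq]
    ring
  simp_rw [h1, tsum_mul_left, h]
  rw [ofReal_mul_cpow (by positivity) hε0, ofReal_sq_cpow_half hpr]
  have h3 : ε ^ (1 / 2 : ℂ) ≠ 0 := by
    rw [Ne, cpow_eq_zero_iff]
    tauto
  simp_rw [← h2, tsum_mul_left]
  push_cast
  field_simp

theorem tsum_periodic_mul_exp {ε : ℂ} (hε : 0 < ε.re) {p : ℕ} (hp : 0 < p) {f : ℤ → ℂ}
    (hf : ∀ n m : ℤ, f (m * p + n) = f n) :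
    ∑' n : ℤ, f n * cexp (-Real.pi * ε * n ^ 2) =
      ∑ j ∈ Finset.range p, f j * ∑' m : ℤ, cexp (-Real.pi * ε * (m * p + j) ^ 2) := by
  have : NeZero p := ⟨hp.ne'⟩
  have hs : ∀ j : ℕ, Summable fun m : ℤ => cexp (-Real.pi * ε * (m * p + j) ^ 2) := by
    intro j
    have hinj : Function.Injective fun m : ℤ => m * p + j := by
      intro a b hab
      simpa [hp.ne'] using hab
    refine ((summable_exp_neg_mul_sq hε).comp_injective hinj).congr fun m => ?_
    simp
  have h1 : HasSum (fun x : ℤ × Fin p => f (x.2 : ℕ) *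
      cexp (-Real.pi * ε * (x.1 * p + (x.2 : ℕ)) ^ 2))
      (∑ j : Fin p, f (j : ℕ) * ∑' m : ℤ, cexp (-Real.pi * ε * (m * p + (j : ℕ)) ^ 2)) := by
    rw [← (Equiv.prodComm (Fin p) ℤ).hasSum_iff]
    have hsig : ∀ j : Fin p, HasSum (fun m : ℤ => f (j : ℕ) *
        cexp (-Real.pi * ε * (m * p + (j : ℕ)) ^ 2))
        (f (j : ℕ) * ∑' m : ℤ, cexp (-Real.pi * ε * (m * p + (j : ℕ)) ^ 2)) :=
      fun j => (hs j).hasSum.mul_left _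
    have := (hasSum_fintype fun j : Fin p =>
      f (j : ℕ) * ∑' m : ℤ, cexp (-Real.pi * ε * (m * p + (j : ℕ)) ^ 2))
    have hsum : Summable ((fun x : ℤ × Fin p => f (x.2 : ℕ) *
        cexp (-Real.pi * ε * (x.1 * p + (x.2 : ℕ)) ^ 2)) ∘ (Equiv.prodComm (Fin p) ℤ)) := by
      refine Summable.of_norm ((summable_prod_of_nonneg fun _ => norm_nonneg _).2
        ⟨fun j => (hsig j).summable.norm, (hasSum_fintype _).summable⟩)
    have h2 := hsum.hasSum.prod_fiberwise hsig
    rw [this.unique h2]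
    exact hsum.hasSum
  rw [Finset.sum_range (fun j : ℕ => f j * ∑' m : ℤ, cexp (-Real.pi * ε * (m * p + j) ^ 2)),
    ← h1.tsum_eq, ← (Int.divModEquiv p).symm.tsum_eq]
  refine tsum_congr fun x => ?_
  simp only [Int.divModEquiv, Equiv.coe_fn_symm_mk]
  rw [hf]
  push_cast
  rfl

/-- Each residue class modulo `p` contributes `1 / p` in the limit, so a theta series with periodic
weights sees only the mean of the weights. The growth of `Re (1 / ε)` is what sends the dual series
to 1. -/
theorem tendsto_cpow_half_mul_tsum {ι : Type*} {l : Filter ι} {ε : ι → ℂ}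
    (hε : ∀ᶠ i in l, 0 < (ε i).re) (hε' : Tendsto (fun i => (1 / ε i).re) l atTop)
    {p : ℕ} (hp : 0 < p) {f : ℤ → ℂ} (hf : ∀ n m : ℤ, f (m * p + n) = f n) :
    Tendsto (fun i => ε i ^ (1 / 2 : ℂ) * ∑' n : ℤ, f n * cexp (-Real.pi * ε i * n ^ 2)) l
      (𝓝 (1 / p * ∑ j ∈ Finset.range p, f j)) := by
  have h1 : Tendsto (fun i => ∑ j ∈ Finset.range p, f j * (1 / p *
      ∑' n : ℤ, cexp (-Real.pi * (1 / (p ^ 2 * ε i)) * n ^ 2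
        + 2 * Real.pi * I * n * ((j / p : ℝ) : ℝ)))) l
      (𝓝 (∑ j ∈ Finset.range p, f j * (1 / p * 1))) := by
    refine tendsto_finsetSum _ fun j _ => (Tendsto.const_mul _ (Tendsto.const_mul _ ?_))
    refine tendsto_tsum_exp_neg_mul_sq ?_ _
    have hc : (0 : ℝ) < 1 / p ^ 2 := by positivity
    refine (hε'.const_mul_atTop hc).congr fun i => ?_
    rw [← re_ofReal_mul]
    push_cast
    rw [one_div_mul_one_div]
  have h2 : 1 / (p : ℂ) * ∑ j ∈ Finset.range p, f j = ∑ j ∈ Finset.range p, f j * (1 / p * 1) := by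
    rw [Finset.mul_sum]
    exact Finset.sum_congr rfl fun j _ => by ring
  rw [h2]
  refine h1.congr' ?_
  filter_upwards [hε] with i hi
  rw [tsum_periodic_mul_exp hi hp hf, Finset.mul_sum]
  refine Finset.sum_congr rfl fun j _ => ?_
  rw [← tsum_exp_neg_mul_progression hi hp]
  ring

/-- The Landsberg–Schaar relation. -/
theorem landsberg_schaar {p m : ℕ} (hp : 0 < p) (hm : 0 < m) :
    ∑ n ∈ Finset.range p, cexp (2 * Real.pi * I * m * n ^ 2 / p) =
      √(p : ℝ) / √(2 * m : ℝ) * cexp (Real.pi / 4 * I) *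
        ∑ n ∈ Finset.range (2 * m), cexp (-(Real.pi * I * p * n ^ 2 / (2 * m))) := by
  have hpr : (0 : ℝ) < p := by exact_mod_cast hp
  have hmr : (0 : ℝ) < m := by exact_mod_cast hm
  have hp0 : (p : ℂ) ≠ 0 := by exact_mod_cast hp.ne'
  have hm0 : (m : ℂ) ≠ 0 := by exact_mod_cast hm.ne'
  -- With this `c`, `exp (π i c n²)` is the summand on the left and `exp (-π i n² / c)` the one on
  -- the right. The identity is Poisson summation for the theta series at `a = 1/t - i c`, compared
  -- on both sides as `t → ∞`.
  obtain ⟨c, hc⟩ : ∃ c : ℝ, c = 2 * m / p := ⟨_, rfl⟩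
  have hc0 : 0 < c := by rw [hc]; positivity
  have hcc : (c : ℂ) = 2 * m / p := by rw [hc]; push_cast; rfl
  have hcne : (c : ℂ) ≠ 0 := ofReal_ne_zero.2 hc0.ne'
  have hexp : ∀ x : ℤ, cexp (2 * Real.pi * I * x) = 1 := fun x => by
    rw [mul_comm]; exact Complex.exp_int_mul_two_pi_mul_I x
  have hA := tendsto_cpow_half_mul_tsum (l := atTop) (ε := fun t : ℝ => ((t⁻¹ : ℝ) : ℂ))
    (by filter_upwards [eventually_gt_atTop 0] with t ht; simpa using ht)
    (by simpa using! tendsto_id) hp (f := fun n => cexp (2 * Real.pi * I * m * n ^ 2 / p)) (by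
      intro n k
      rw [← mul_one (cexp (2 * Real.pi * I * m * n ^ 2 / p)),
        ← hexp (m * (k ^ 2 * p + 2 * k * n)), ← Complex.exp_add]
      congr 1
      push_cast
      field_simp
      ring)
  have hden : ∀ t : ℝ, 0 < t → (c : ℂ) ^ 2 * t + I * c ≠ 0 := by
    intro t ht h0
    have := congrArg im h0
    rw [← ofReal_pow, ← ofReal_mul] at this
    simp only [add_im, ofReal_im, mul_im, I_re, I_im, ofReal_re, zero_im] at this
    linarith
  -- This `ε` is what is left of `1 / a` after removing the constant `i / c`, which goes into the
  -- periodic weights; see `e3`.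
  have hB := tendsto_cpow_half_mul_tsum (l := atTop)
    (ε := fun t : ℝ => 1 / ((c : ℂ) ^ 2 * t + I * c))
    (by
      filter_upwards [eventually_gt_atTop 0] with t ht
      rw [one_div, inv_re]
      refine div_pos ?_ (normSq_pos.2 (hden t ht))
      rw [← ofReal_pow, ← ofReal_mul]
      simp only [add_re, ofReal_re, mul_re, I_re, I_im, ofReal_im]
      have : 0 < c ^ 2 * t := by positivity
      linarith)
    (by
      have hc2 : 0 < c ^ 2 := by positivity
      refine (tendsto_id.const_mul_atTop hc2).congr fun t => ?_
      rw [one_div_one_div, ← ofReal_pow, ← ofReal_mul]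
      simp only [add_re, ofReal_re, mul_re, I_re, I_im, ofReal_im, id]
      ring)
    (p := 2 * m) (by omega) (f := fun n => cexp (-(Real.pi * I * p * n ^ 2 / (2 * m)))) (by
      intro n k
      rw [← mul_one (cexp (-(Real.pi * I * p * n ^ 2 / (2 * m)))),
        ← hexp (-(p * (k ^ 2 * m + k * n))), ← Complex.exp_add]
      congr 1
      push_cast
      field_simp
      ring)
  have hlim : Tendsto (fun t : ℝ => ((t⁻¹ : ℝ) : ℂ)) atTop (𝓝 0) := by
    exact (continuous_ofReal.tendsto' 0 0 ofReal_zero).comp tendsto_inv_atTop_zero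
  -- Quotient of the two normalising factors, the common `t^(-1/2)` removed. The limits `1 / c²` and
  -- `-i c` of the bases lie in the slit plane, so the principal square roots are continuous there.
  have hC : Tendsto (fun t : ℝ => (1 / ((c : ℂ) ^ 2 + I * c * ((t⁻¹ : ℝ) : ℂ))) ^ (1 / 2 : ℂ) *
      (((t⁻¹ : ℝ) : ℂ) - I * c) ^ (1 / 2 : ℂ)) atTop
      (𝓝 ((1 / ((c : ℂ) ^ 2 + I * c * 0)) ^ (1 / 2 : ℂ) * (0 - I * c) ^ (1 / 2 : ℂ))) := by
    refine Tendsto.mul (Tendsto.cpow ?_ tendsto_const_nhds ?_)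
      (Tendsto.cpow ?_ tendsto_const_nhds ?_)
    · refine tendsto_const_nhds.div (tendsto_const_nhds.add (hlim.const_mul _)) ?_
      simpa using hcne
    · left
      rw [mul_zero, add_zero, ← ofReal_pow, ← ofReal_one, ← ofReal_div, ofReal_re]
      positivity
    · exact hlim.sub_const _
    · right
      simpa using hc0.ne'
  have hkey := hC.mul hA
  have huniq := tendsto_nhds_unique (hkey.congr' ?_) hB
  swap
  · filter_upwards [eventually_gt_atTop 0] with t ht
    have ht0 : (t : ℂ) ≠ 0 := ofReal_ne_zero.2 ht.ne'
    have hd := hden t ht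
    have hane : ((t⁻¹ : ℝ) : ℂ) - I * c ≠ 0 := by
      intro h0
      have := congrArg im h0
      simp [hc0.ne'] at this
    have hP := Complex.tsum_exp_neg_mul_int_sq (a := ((t⁻¹ : ℝ) : ℂ) - I * c) (by simpa using ht)
    have e1 : ∀ n : ℤ, cexp (2 * Real.pi * I * m * n ^ 2 / p) *
        cexp (-Real.pi * ((t⁻¹ : ℝ) : ℂ) * n ^ 2) =
        cexp (-Real.pi * (((t⁻¹ : ℝ) : ℂ) - I * c) * n ^ 2) := by
      intro n
      rw [← Complex.exp_add, hcc]
      congr 1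
      field_simp
      ring
    have e2 : ∀ n : ℤ, cexp (-(Real.pi * I * p * n ^ 2 / (2 * m))) *
        cexp (-Real.pi * (1 / ((c : ℂ) ^ 2 * t + I * c)) * n ^ 2) =
        cexp (-Real.pi / (((t⁻¹ : ℝ) : ℂ) - I * c) * n ^ 2) := by
      intro n
      rw [← Complex.exp_add]
      congr 1
      have hpm : (p / (2 * m) : ℂ) = 1 / c := by rw [hcc]; field_simp
      have e3 : 1 / (((t⁻¹ : ℝ) : ℂ) - I * c) = 1 / ((c : ℂ) ^ 2 * t + I * c) + I * (1 / c) := by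
        have hta : (t : ℂ) * (((t⁻¹ : ℝ) : ℂ) - I * c) = 1 - I * c * t := by
          push_cast
          field_simp
        have hD : (c : ℂ) ^ 2 * t + I * c = I * c * (t * (((t⁻¹ : ℝ) : ℂ) - I * c)) := by
          rw [hta]
          linear_combination ((c : ℂ) ^ 2 * t) * I_sq
        rw [hD]
        generalize ((t⁻¹ : ℝ) : ℂ) - I * c = a at hta hane
        field_simp
        linear_combination hta - t * a * I_sq
      rw [div_eq_mul_one_div (-(Real.pi : ℂ)), e3, ← hpm]
      ring
    simp_rw [e1, e2, hP]
    have e4 : (1 / ((c : ℂ) ^ 2 * t + I * c)) ^ (1 / 2 : ℂ) = ((t⁻¹ : ℝ) : ℂ) ^ (1 / 2 : ℂ) *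
        (1 / ((c : ℂ) ^ 2 + I * c * ((t⁻¹ : ℝ) : ℂ))) ^ (1 / 2 : ℂ) := by
      have e5 : (c : ℂ) ^ 2 + I * c * ((t⁻¹ : ℝ) : ℂ) = ((c : ℂ) ^ 2 * t + I * c) / t := by
        push_cast
        field_simp
      have e6 : (c : ℂ) ^ 2 + I * c * ((t⁻¹ : ℝ) : ℂ) ≠ 0 := by
        rw [e5]; exact div_ne_zero hd ht0
      rw [← ofReal_mul_cpow (by positivity) (one_div_ne_zero e6), e5]
      congr 1
      push_cast
      field_simp
    have h5 : (((t⁻¹ : ℝ) : ℂ) - I * c) ^ (1 / 2 : ℂ) ≠ 0 := by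
      rw [Ne, cpow_eq_zero_iff]; tauto
    rw [e4, ← mul_assoc, mul_comm (((t⁻¹ : ℝ) : ℂ) ^ (1 / 2 : ℂ))]
    generalize (((t⁻¹ : ℝ) : ℂ) - I * c) ^ (1 / 2 : ℂ) = x at h5
    field_simp
  have h6 : (1 / ((c : ℂ) ^ 2 + I * c * 0)) ^ (1 / 2 : ℂ) = 1 / c := by
    have := ofReal_sq_cpow_half (x := 1 / c) (by positivity)
    rw [mul_zero, add_zero]
    push_cast at this
    rw [← this]
    congr 1
    field_simp
  have h7 : (0 - I * (c : ℂ)) ^ (1 / 2 : ℂ) = √c * cexp (-(Real.pi / 4 * I)) := by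
    rw [show (0 - I * (c : ℂ)) = (c : ℂ) * (-I) by ring, ofReal_mul_cpow hc0 (by simp),
      show (-I) ^ (1 / 2 : ℂ) = cexp (-(Real.pi / 4 * I)) by
        rw [cpow_def_of_ne_zero (by simp), log_neg_I]; congr 1; ring,
      show (1 / 2 : ℂ) = ((1 / 2 : ℝ) : ℂ) by push_cast; ring, ← ofReal_cpow hc0.le,
      ← Real.sqrt_eq_rpow]
  rw [h6, h7] at huniq
  have h8 : (√c : ℂ) = √(2 * m : ℝ) / √(p : ℝ) := by
    rw [hc, Real.sqrt_div (by positivity)]; push_cast; rfl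
  have h9 : (√(p : ℝ) : ℂ) ≠ 0 := ofReal_ne_zero.2 (Real.sqrt_pos.2 hpr).ne'
  have h10 : (√(2 * m : ℝ) : ℂ) ≠ 0 := ofReal_ne_zero.2 (Real.sqrt_pos.2 (by positivity)).ne'
  have h11 : (√(2 * m : ℝ) : ℂ) ^ 2 = 2 * m := by
    rw [← ofReal_pow, Real.sq_sqrt (by positivity)]; push_cast; rfl
  have h12 : (√(p : ℝ) : ℂ) ^ 2 = p := by
    rw [← ofReal_pow, Real.sq_sqrt (by positivity)]; push_cast; rfl
  have h13 := Complex.exp_ne_zero (Real.pi / 4 * I)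
  push_cast at huniq
  rw [h8, hcc, Complex.exp_neg] at huniq
  generalize ∑ n ∈ Finset.range p, cexp (2 * Real.pi * I * m * n ^ 2 / p) = x at huniq ⊢
  generalize ∑ n ∈ Finset.range (2 * m), cexp (-(Real.pi * I * p * n ^ 2 / (2 * m))) = y
    at huniq ⊢
  rw [← h11, ← h12] at huniq
  generalize (√(2 * m : ℝ) : ℂ) = u at *
  generalize (√(p : ℝ) : ℂ) = w at *
  generalize cexp (Real.pi / 4 * I) = e at *
  field_simp at huniq ⊢
  linear_combination huniq

/-! ### Explicit values of the Gauss sums, by reciprocity. -/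

theorem exp_pi_div_four_mul_I : cexp (Real.pi / 4 * I) = (1 + I) / √2 := by
  rw [Complex.exp_mul_I, show (Real.pi / 4 : ℂ) = ((Real.pi / 4 : ℝ) : ℂ) by push_cast; rfl,
    ← ofReal_cos, ← ofReal_sin, Real.cos_pi_div_four, Real.sin_pi_div_four]
  have h : (√2 : ℂ) ^ 2 = 2 := by rw [← ofReal_pow, Real.sq_sqrt (by norm_num)]; norm_num
  have h0 : (√2 : ℂ) ≠ 0 := by rintro h0; simp [h0] at h
  push_cast
  field_simp
  linear_combination (1 + I) * h

theorem exp_neg_pi_mul_I_div_two (n : ℕ) : cexp (-(Real.pi * I * n / 2)) = (-I) ^ n := by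
  rw [show -(Real.pi * I * n / 2 : ℂ) = n * (-(Real.pi / 2 * I)) by ring, Complex.exp_nat_mul,
    Complex.exp_neg, Complex.exp_pi_div_two_mul_I, inv_I]

/-- Reciprocity with `m = 1`: the dual sum has only the terms `1` and `(-i)^N`. -/
theorem sum_exp_sq {N : ℕ} (hN : 0 < N) :
    ∑ n ∈ Finset.range N, cexp (2 * Real.pi * I * n ^ 2 / N) =
      √(N : ℝ) * ((1 + I) / 2 * (1 + (-I) ^ N)) := by
  have h := landsberg_schaar hN one_pos
  have h2 : (√2 : ℂ) ^ 2 = 2 := by rw [← ofReal_pow, Real.sq_sqrt (by norm_num)]; norm_num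
  have h0 : (√2 : ℂ) ≠ 0 := by rintro h0; simp [h0] at h2
  have h1 := exp_neg_pi_mul_I_div_two N
  simp only [Finset.sum_range_succ, Finset.sum_range_zero, Nat.cast_one, mul_one, Nat.cast_zero,
    one_pow, exp_pi_div_four_mul_I, h1] at h
  rw [h]
  simp only [ne_eq, OfNat.ofNat_ne_zero, not_false_eq_true, zero_pow, mul_zero, zero_div, neg_zero,
    Complex.exp_zero, zero_add]
  field_simp
  linear_combination (-(√(N : ℝ) : ℂ) * (1 + I) * (1 + (-I) ^ N)) * h2

theorem sum_exp_sq_of_four_dvd {N : ℕ} (hN : 0 < N) (h4 : 4 ∣ N) :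
    ∑ n ∈ Finset.range N, cexp (2 * Real.pi * I * n ^ 2 / N) = √(N : ℝ) * (1 + I) := by
  obtain ⟨k, rfl⟩ := h4
  rw [sum_exp_sq hN, pow_mul, show (-I) ^ 4 = 1 by rw [neg_pow, I_pow_four]; norm_num, one_pow]
  ring

theorem sum_exp_sq_of_odd {N : ℕ} (hN : Odd N) :
    ∑ n ∈ Finset.range N, cexp (2 * Real.pi * I * n ^ 2 / N) =
      √(N : ℝ) * (jacobiSym 2 N * I ^ (-(((N : ℤ) - 1) / 2))) := by
  rw [sum_exp_sq hN.pos, jacobiSym.at_two hN]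
  congr 1
  -- The Jacobi symbol is the character `χ₈`, and every other factor also depends only on `N` modulo
  -- 8.
  obtain ⟨j, hj⟩ : ∃ j, N = 8 * j + 1 ∨ N = 8 * j + 3 ∨ N = 8 * j + 5 ∨ N = 8 * j + 7 := by
    obtain ⟨i, hi⟩ := hN
    exact ⟨N / 8, by omega⟩
  have h8 : (-I) ^ 8 = 1 := by
    rw [show 8 = 4 * 2 from rfl, pow_mul, neg_pow, I_pow_four]; norm_num
  have h4 : I ^ (4 : ℤ) = 1 := by exact_mod_cast I_pow_four
  have key : ∀ i : ℕ, (-I) ^ (8 * j + i) = (-I) ^ i := fun i => by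
    rw [pow_add, pow_mul, h8, one_pow, one_mul]
  have key' : ∀ i : ℤ, I ^ (4 * (-(j : ℤ)) + i) = I ^ i := fun i => by
    rw [zpow_add₀ I_ne_zero, zpow_mul, h4, one_zpow, one_mul]
  have hI : I ^ (-1 : ℤ) = -I := by rw [zpow_neg_one, inv_I]
  have h3 : (-I) ^ 3 = I := by linear_combination (-I) * I_sq
  have hχ : ∀ i < 8, ZMod.χ₈ ((8 * j + i : ℕ) : ZMod 8) = ZMod.χ₈ (i : ℕ) := fun i hi => by
    rw [ZMod.χ₈_nat_mod_eight, Nat.mul_add_mod, Nat.mod_eq_of_lt hi]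
  rcases hj with rfl | rfl | rfl | rfl
  · rw [key, hχ 1 (by norm_num), show ZMod.χ₈ (1 : ℕ) = 1 by decide,
      show -((((8 * j + 1 : ℕ) : ℤ) - 1) / 2) = 4 * (-(j : ℤ)) + 0 by omega, key']
    simp only [pow_one, Int.cast_one, zpow_zero]
    linear_combination (-1 / 2) * I_sq
  · rw [key, hχ 3 (by norm_num), show ZMod.χ₈ (3 : ℕ) = -1 by decide,
      show -((((8 * j + 3 : ℕ) : ℤ) - 1) / 2) = 4 * (-(j : ℤ)) + (-1) by omega, key', hI, h3]
    push_cast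
    linear_combination (1 / 2) * I_sq
  · rw [key, hχ 5 (by norm_num), show ZMod.χ₈ (5 : ℕ) = -1 by decide,
      show -((((8 * j + 5 : ℕ) : ℤ) - 1) / 2) = 4 * (-(j : ℤ)) + ((-1) + (-1)) by omega, key',
      zpow_add₀ I_ne_zero, hI, show 5 = 3 + 2 from rfl, pow_add, h3]
    push_cast
    linear_combination (1 / 2 * I + 1 / 2 * I ^ 2 + 1 / 2) * I_sq
  · rw [key, hχ 7 (by norm_num), show ZMod.χ₈ (7 : ℕ) = 1 by decide,
      show -((((8 * j + 7 : ℕ) : ℤ) - 1) / 2) = 4 * (-(j : ℤ)) + ((-1) + (-1) + (-1)) by omega,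
      key', zpow_add₀ I_ne_zero, zpow_add₀ I_ne_zero, hI, show 7 = 3 + 3 + 1 from rfl, pow_add,
      pow_add, h3]
    push_cast
    linear_combination (-I ^ 2 / 2 + I / 2 + 1 / 2) * I_sq

/-- Reciprocity with `m = 2`: in the dual sum over four terms, those at 0 and 2 cancel because `N`
is odd, and those at 1 and 3 agree. No Jacobi symbol appears. -/
theorem sum_exp_two_mul_sq_of_odd {N : ℕ} (hN : Odd N) :
    ∑ n ∈ Finset.range N, cexp (2 * Real.pi * I * (2 * n ^ 2) / N) =
      √(N : ℝ) * I ^ (-(((N : ℤ) - 1) / 2)) := by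
  have h := landsberg_schaar hN.pos two_pos
  obtain ⟨j, hj⟩ := hN
  have hj' : ((N : ℤ) - 1) / 2 = j := by omega
  have hs : (√(2 * (2 : ℕ) : ℝ)) = 2 := by
    rw [show (2 * (2 : ℕ) : ℝ) = 2 ^ 2 by norm_num]
    exact Real.sqrt_sq (by norm_num)
  have e1 : cexp (-(Real.pi * I * N * 2 ^ 2 / (2 * 2))) = -1 := by
    rw [show -(Real.pi * I * N * 2 ^ 2 / (2 * 2) : ℂ) = (-(j + 1 : ℤ)) * (2 * Real.pi * I) + Real.pi * I by
      rw [hj]; push_cast; ring, Complex.exp_add]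
    have := Complex.exp_int_mul_two_pi_mul_I (-(j + 1 : ℤ))
    push_cast at this ⊢
    rw [this, exp_pi_mul_I]
    ring
  have e2 : cexp (-(Real.pi * I * N * 3 ^ 2 / (2 * 2))) = cexp (-(Real.pi * I * N / (2 * 2))) := by
    rw [show -(Real.pi * I * N * 3 ^ 2 / (2 * 2) : ℂ) = (-(N : ℤ) : ℤ) * (2 * Real.pi * I) + -(Real.pi * I * N / (2 * 2)) by
      push_cast; ring, Complex.exp_add, Complex.exp_int_mul_two_pi_mul_I, one_mul]
  have e3 : cexp (Real.pi / 4 * I) * cexp (-(Real.pi * I * N / (2 * 2))) = (-I) ^ j := by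
    rw [← exp_neg_pi_mul_I_div_two, ← Complex.exp_add, hj]
    congr 1
    push_cast
    ring
  rw [hs] at h
  simp only [Finset.sum_range_succ, Finset.sum_range_zero, Nat.cast_ofNat, Nat.cast_one,
    Nat.cast_zero, e1, e2, one_pow, mul_one, show 2 * 2 = 4 from rfl] at h
  rw [hj', zpow_neg, ← inv_zpow, inv_I, zpow_natCast, ← e3]
  convert h using 1
  · refine Finset.sum_congr rfl fun n _ => ?_
    congr 1
    ring
  · push_cast
    simp only [ne_eq, OfNat.ofNat_ne_zero, not_false_eq_true, zero_pow, mul_zero, zero_div, neg_zero,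
    Complex.exp_zero, zero_add]
    ring

end GaussSum

noncomputable section

namespace SmallQuantum

/-! ### Sums of periodic functions -/

/-- This is the change of variable behind every completion of a square below. -/
theorem sum_range_periodic_add {M : Type*} [AddCommGroup M] {N : ℕ} {g : ℤ → M}
    (hg : ∀ x, g (x + N) = g x) (m : ℤ) :
    ∑ i ∈ Finset.range N, g (i + m) = ∑ i ∈ Finset.range N, g i := by
  have step : ∀ m : ℤ, ∑ i ∈ Finset.range N, g (i + (m + 1)) = ∑ i ∈ Finset.range N, g (i + m) := by
    intro m
    have h1 := Finset.sum_range_succ (fun i : ℕ => g (i + m)) N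
    rw [Finset.sum_range_succ'] at h1
    have h2 : g ((N : ℤ) + m) = g (((0 : ℕ) : ℤ) + m) := by
      rw [add_comm, hg]; simp
    rw [h2] at h1
    rw [← add_right_cancel h1]
    refine Finset.sum_congr rfl fun i _ => ?_
    congr 1
    push_cast
    ring
  induction m with
  | zero => simp
  | succ m ih => rw [step, ih]
  | pred m ih => rw [← step, ← ih]; simp

/-! ### Commutation relations -/

section

variable {A : Type*} [Ring A] [Algebra ℂ A]

theorem units_zpow_mul_of_mul_eq_smul {k : Aˣ} {x : A} {s : ℂ} (hs : s ≠ 0)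
    (h : (k : A) * x = s • (x * k)) (m : ℤ) :
    ((k ^ m : Aˣ) : A) * x = s ^ m • (x * (k ^ m : Aˣ)) := by
  have hinv : ((k⁻¹ : Aˣ) : A) * x = s⁻¹ • (x * (k⁻¹ : Aˣ)) := by
    rw [Units.inv_mul_eq_iff_eq_mul, mul_smul_comm, ← mul_assoc, h, smul_mul_assoc, smul_smul,
      inv_mul_cancel₀ hs, one_smul, Units.mul_inv_cancel_right]
  induction m with
  | zero => simp
  | succ m ih =>
    rw [zpow_add_one, Units.val_mul, mul_assoc, h, mul_smul_comm, ← mul_assoc, ih,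
      smul_mul_assoc, smul_smul, mul_assoc, zpow_add_one₀ hs, mul_comm s]
  | pred m ih =>
    rw [zpow_sub_one, Units.val_mul, mul_assoc, hinv, mul_smul_comm, ← mul_assoc, ih,
      smul_mul_assoc, smul_smul, mul_assoc, zpow_sub_one₀ hs, mul_comm s⁻¹]

end

/-- Integral powers of `K`, as elements of the algebra. -/
def Kpow (r : ℕ) (m : ℤ) : SmallQuantumSl2 r := (K r ^ m : (SmallQuantumSl2 r)ˣ)

theorem Kpow_zero (r : ℕ) : Kpow r 0 = 1 := by simp [Kpow]

theorem Kpow_one (r : ℕ) : Kpow r 1 = gen r Gen.K := by simp [Kpow, K]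

theorem Kpow_neg_one (r : ℕ) : Kpow r (-1) = gen r Gen.Kinv := by simp [Kpow, K]

theorem Kpow_mul (r : ℕ) (m n : ℤ) : Kpow r m * Kpow r n = Kpow r (m + n) := by
  simp [Kpow, zpow_add]

theorem Kpow_mul_mul (r : ℕ) (m n : ℤ) (x : SmallQuantumSl2 r) :
    Kpow r m * (Kpow r n * x) = Kpow r (m + n) * x := by
  rw [← mul_assoc, Kpow_mul]

theorem Kpow_add_r₁ (r : ℕ) (m : ℤ) : Kpow r (m + r₁ r) = Kpow r m := by
  have h : Kpow r (r₁ r) = 1 := by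
    simpa [Kpow, K] using gen_K_pow r
  rw [← Kpow_mul, h, mul_one]

theorem Kpow_mul_E_pow (r : ℕ) (m : ℤ) (a : ℕ) :
    Kpow r m * E r ^ a = q r ^ (2 * m * a) • (E r ^ a * Kpow r m) := by
  have h := units_zpow_mul_of_mul_eq_smul (k := K r) (x := E r)
    (zpow_ne_zero _ (q_ne_zero r)) (K_mul_E r) m
  rw [Kpow, y_mul_x_pow h, ← zpow_mul, ← zpow_natCast, ← zpow_mul]

theorem Kpow_mul_F_pow (r : ℕ) (m : ℤ) (a : ℕ) :
    Kpow r m * F r ^ a = q r ^ (-2 * m * a) • (F r ^ a * Kpow r m) := by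
  have h := units_zpow_mul_of_mul_eq_smul (k := K r) (x := F r)
    (zpow_ne_zero _ (q_ne_zero r)) (K_mul_F r) m
  rw [Kpow, y_mul_x_pow h, ← zpow_mul, ← zpow_natCast, ← zpow_mul]

theorem Kpow_mul_E (r : ℕ) (m : ℤ) :
    Kpow r m * E r = q r ^ (2 * m) • (E r * Kpow r m) := by
  simpa using Kpow_mul_E_pow r m 1

theorem Kpow_mul_F (r : ℕ) (m : ℤ) :
    Kpow r m * F r = q r ^ (-2 * m) • (F r * Kpow r m) := by
  simpa using Kpow_mul_F_pow r m 1

theorem E_mul_F_Kpow (r : ℕ) :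
    E r * F r = F r * E r + (brace r 1)⁻¹ • (Kpow r 1 - Kpow r (-1)) := by
  rw [Kpow_one, Kpow_neg_one, brace, zpow_neg, zpow_one]
  exact E_mul_F r

section

variable (r : ℕ) [Fact (2 < r)]

theorem q_pow_two_r₁ : q r ^ (2 * (r₁ r : ℤ)) = 1 := by
  rw [zpow_mul, zpow_natCast]
  exact (q_sq_primitive r).pow_eq_one

theorem q_zpow_two_mul_ne_one {n : ℤ} (h : ¬ (r₁ r : ℤ) ∣ n) : q r ^ (2 * n) ≠ 1 := by
  rw [zpow_mul]
  exact fun h' => h ((q_sq_primitive r).zpow_eq_one_iff_dvd n |>.1 h')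

/-- Since `q²` has order `r'` for either parity of `r`, this congruence serves all cases. For odd
`r` it is weaker than the one modulo `r` in `q_zpow_eq_of_dvd`. -/
theorem q_zpow_congr {m n : ℤ} (h : 2 * (r₁ r : ℤ) ∣ m - n) : q r ^ m = q r ^ n := by
  obtain ⟨x, hx⟩ := h
  rw [show m = 2 * (r₁ r : ℤ) * x + n by linarith, zpow_add₀ (q_ne_zero r), zpow_mul,
    q_pow_two_r₁, one_zpow, one_mul]

theorem brace_ne_zero {n : ℤ} (h : ¬ (r₁ r : ℤ) ∣ n) : brace r n ≠ 0 := by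
  intro h0
  refine q_zpow_two_mul_ne_one r h ?_
  rw [brace, sub_eq_zero] at h0
  rw [two_mul, zpow_add₀ (q_ne_zero r)]
  nth_rewrite 1 [h0]
  rw [← zpow_add₀ (q_ne_zero r), neg_add_cancel, zpow_zero]

theorem one_lt_r₁ : 1 < r₁ r := by
  have h : 2 < r := Fact.out
  unfold r₁
  have h1 : Nat.gcd r 2 ≤ 2 := Nat.gcd_le_right _ two_pos
  have h2 : Nat.gcd r 2 * (r / Nat.gcd r 2) = r := Nat.mul_div_cancel' (Nat.gcd_dvd_left r 2)
  nlinarith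

theorem brace_one_ne_zero : brace r 1 ≠ 0 := by
  refine brace_ne_zero r fun h => ?_
  have h1 := Int.le_of_dvd one_pos h
  have h2 := one_lt_r₁ r
  omega

theorem qInt_ne_zero {n : ℕ} (h0 : 0 < n) (h : n < r₁ r) : qInt r n ≠ 0 := by
  refine div_ne_zero (brace_ne_zero r fun h' => ?_) (brace_one_ne_zero r)
  have h1 := Int.le_of_dvd (by omega) h'
  omega

end

/-! ### Quantum integers and commutators of powers of `E` and `F`. -/

theorem brace_neg_one (r : ℕ) : brace r (-1) = -brace r 1 := by
  simp [brace]

theorem qInt_zero (r : ℕ) : qInt r 0 = 0 := by simp [qInt, brace]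

theorem qFact_succ (r n : ℕ) : qFact r (n + 1) = qFact r n * qInt r ((n + 1 : ℕ) : ℤ) := by
  rw [qFact, Finset.prod_range_succ]
  push_cast
  rfl

section

variable (r : ℕ) [Fact (2 < r)]

theorem qInt_add (a b : ℤ) : qInt r (a + b) = q r ^ b * qInt r a + q r ^ (-a) * qInt r b := by
  have hb := brace_one_ne_zero r
  simp only [qInt]
  field_simp
  simp only [brace, neg_add, zpow_add₀ (q_ne_zero r)]
  ring

theorem qInt_one : qInt r 1 = 1 := div_self (brace_one_ne_zero r)

theorem qInt_succ (a : ℕ) : qInt r ((a + 1 + 1 : ℕ) : ℤ) =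
    q r * qInt r ((a + 1 : ℕ) : ℤ) + q r ^ (-((a + 1 : ℕ) : ℤ)) := by
  have h := qInt_add r ((a + 1 : ℕ) : ℤ) 1
  rw [qInt_one, zpow_one, mul_one] at h
  exact_mod_cast h

theorem qInt_succ' (a : ℕ) : qInt r ((a + 1 + 1 : ℕ) : ℤ) =
    q r ^ ((a + 1 : ℕ) : ℤ) + q r ^ (-1 : ℤ) * qInt r ((a + 1 : ℕ) : ℤ) := by
  have h := qInt_add r 1 ((a + 1 : ℕ) : ℤ)
  rw [qInt_one, mul_one] at h
  rw [← h]
  congr 1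
  push_cast
  ring

theorem E_pow_succ_mul_F (a : ℕ) :
    E r ^ (a + 1) * F r = F r * E r ^ (a + 1) + (qInt r ((a + 1 : ℕ) : ℤ) / brace r 1) •
      (E r ^ a * (q r ^ (a : ℤ) • Kpow r 1 - q r ^ (-(a : ℤ)) • Kpow r (-1))) := by
  have hq := q_ne_zero r
  have hb := brace_one_ne_zero r
  induction a with
  | zero => simp [E_mul_F_Kpow, qInt, hb]
  | succ a ih =>
    rw [pow_succ', mul_assoc, ih, mul_add, ← mul_assoc, E_mul_F_Kpow, add_mul, mul_assoc,
      ← pow_succ', add_assoc]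
    congr 1
    rw [smul_mul_assoc, sub_mul, Kpow_mul_E_pow, Kpow_mul_E_pow, mul_smul_comm, ← mul_assoc,
      ← pow_succ']
    simp only [mul_sub, mul_smul_comm, smul_sub, smul_smul]
    rw [sub_add_sub_comm, ← add_smul, ← add_smul]
    congr 2
    · rw [qInt_succ']
      push_cast
      simp only [mul_add, mul_one, two_mul, zpow_add₀ hq, zpow_neg, zpow_one]
      field_simp
    · rw [qInt_succ]
      push_cast
      rw [show -2 * ((a : ℤ) + 1) = -(a + 1) + -(a + 1) by ring]
      simp only [neg_add, zpow_add₀ hq, zpow_neg, zpow_one]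
      field_simp
      ring

theorem E_mul_F_pow_succ (a : ℕ) :
    E r * F r ^ (a + 1) = F r ^ (a + 1) * E r + (qInt r ((a + 1 : ℕ) : ℤ) / brace r 1) •
      (F r ^ a * (q r ^ (-(a : ℤ)) • Kpow r 1 - q r ^ (a : ℤ) • Kpow r (-1))) := by
  have hq := q_ne_zero r
  have hb := brace_one_ne_zero r
  induction a with
  | zero => simp [E_mul_F_Kpow, qInt, hb]
  | succ a ih =>
    rw [pow_succ, ← mul_assoc, ih, add_mul, mul_assoc, E_mul_F_Kpow, mul_add, ← mul_assoc,
      add_assoc]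
    congr 1
    rw [mul_smul_comm, mul_sub, smul_mul_assoc, mul_assoc, sub_mul, smul_mul_assoc,
      smul_mul_assoc, Kpow_mul_F, Kpow_mul_F]
    simp only [mul_sub, mul_smul_comm, smul_sub, smul_smul, ← mul_assoc, ← pow_succ]
    rw [sub_add_sub_comm, ← add_smul, ← add_smul]
    congr 2
    · rw [qInt_succ']
      push_cast
      simp only [neg_add, zpow_add₀ hq, zpow_neg, zpow_one]
      field_simp
    · rw [qInt_succ]
      push_cast
      simp only [neg_add, zpow_add₀ hq, zpow_neg, zpow_one]
      field_simp
      ring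

end

section

variable (r : ℕ)

/-! ### The spectral idempotents of `K` and the Gaussian elements -/

/-- The idempotent projecting onto the eigenspace of `K` for the eigenvalue `q ^ (2 * c)`. -/
def idem (c : ℤ) : SmallQuantumSl2 r :=
  (1 / (r₁ r : ℂ)) • ∑ d ∈ Finset.range (r₁ r), q r ^ (-2 * c * (d : ℤ)) • Kpow r d

theorem idem_mul_E_pow (c : ℤ) (a : ℕ) : idem r c * E r ^ a = E r ^ a * idem r (c - a) := by
  unfold idem
  rw [smul_mul_assoc, mul_smul_comm, Finset.sum_mul, Finset.mul_sum]
  congr 1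
  refine Finset.sum_congr rfl fun d _ => ?_
  rw [smul_mul_assoc, Kpow_mul_E_pow, mul_smul_comm, smul_smul, ← zpow_add₀ (q_ne_zero r)]
  congr 2
  ring

theorem idem_mul_F (c : ℤ) : idem r c * F r = F r * idem r (c + 1) := by
  unfold idem
  rw [smul_mul_assoc, mul_smul_comm, Finset.sum_mul, Finset.mul_sum]
  congr 1
  refine Finset.sum_congr rfl fun d _ => ?_
  rw [smul_mul_assoc, Kpow_mul_F, mul_smul_comm, smul_smul, ← zpow_add₀ (q_ne_zero r)]
  congr 2
  ring

/-- The element acting by `q ^ (2 * n * c ^ 2)` on the eigenspace of `K` for `q ^ (2 * c)`. -/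
def gaussian (n : ℤ) : SmallQuantumSl2 r :=
  ∑ c ∈ Finset.range (r₁ r), q r ^ (2 * n * (c : ℤ) ^ 2) • idem r c

theorem commute_Kpow_gaussian (m n : ℤ) : Commute (Kpow r m) (gaussian r n) := by
  unfold gaussian idem
  refine Commute.sum_right _ _ _ fun c _ => (Commute.smul_right (Commute.smul_right
    (Commute.sum_right _ _ _ fun d _ => Commute.smul_right ?_ _) _) _)
  rw [Commute, SemiconjBy, Kpow_mul, Kpow_mul, add_comm]

variable [Fact (2 < r)]

theorem r₁_cast_ne_zero : (r₁ r : ℂ) ≠ 0 := by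
  exact_mod_cast (r₁_pos r).ne'

theorem idem_add_r₁ (c : ℤ) : idem r (c + r₁ r) = idem r c := by
  unfold idem
  congr 1
  refine Finset.sum_congr rfl fun d _ => ?_
  rw [q_zpow_congr r (m := -2 * (c + r₁ r) * d) (n := -2 * c * d) ⟨-d, by ring⟩]

theorem q_smul_Kpow_periodic (c x : ℤ) :
    q r ^ (-2 * c * (x + r₁ r)) • Kpow r (x + r₁ r) = q r ^ (-2 * c * x) • Kpow r x := by
  rw [Kpow_add_r₁, q_zpow_congr r (m := -2 * c * (x + r₁ r)) (n := -2 * c * x) ⟨-c, by ring⟩]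

/-- Multiplication by `K^m` translates the summation index of the idempotent, which runs over a full
period. -/
theorem Kpow_mul_idem (m c : ℤ) : Kpow r m * idem r c = q r ^ (2 * m * c) • idem r c := by
  unfold idem
  rw [mul_smul_comm, Finset.mul_sum, smul_comm (q r ^ (2 * m * c)), Finset.smul_sum (r := q r ^ _),
    ← sum_range_periodic_add (N := r₁ r) (g := fun x => q r ^ (2 * m * c) •
      (q r ^ (-2 * c * x) • Kpow r x)) (fun x => by rw [q_smul_Kpow_periodic]) m]
  congr 1
  refine Finset.sum_congr rfl fun d _ => ?_
  rw [mul_smul_comm, Kpow_mul, smul_smul, ← zpow_add₀ (q_ne_zero r), add_comm m]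
  congr 2
  ring

theorem sum_q_zpow {n : ℤ} (h : ¬ (r₁ r : ℤ) ∣ n) :
    ∑ d ∈ Finset.range (r₁ r), q r ^ (2 * n * (d : ℤ)) = 0 := by
  have h1 := q_zpow_two_mul_ne_one r h
  have h2 := mul_neg_geom_sum (q r ^ (2 * n)) (r₁ r)
  have h3 : (q r ^ (2 * n)) ^ r₁ r = 1 := by
    rw [← zpow_natCast, ← zpow_mul, mul_right_comm, zpow_mul, q_pow_two_r₁, one_zpow]
  rw [h3, sub_self, mul_eq_zero, sub_eq_zero] at h2
  have h4 := h2.resolve_left (Ne.symm h1)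
  rw [← h4]
  refine Finset.sum_congr rfl fun d _ => ?_
  rw [zpow_mul, zpow_natCast]

theorem idem_mul_idem (c c' : ℤ) : idem r c * idem r c' =
    (1 / (r₁ r : ℂ) * ∑ d ∈ Finset.range (r₁ r), q r ^ (2 * (c' - c) * (d : ℤ))) • idem r c' := by
  nth_rewrite 1 [idem]
  rw [smul_mul_assoc, Finset.sum_mul, mul_smul, Finset.sum_smul]
  congr 1
  refine Finset.sum_congr rfl fun d _ => ?_
  rw [smul_mul_assoc, Kpow_mul_idem, smul_smul, ← zpow_add₀ (q_ne_zero r)]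
  congr 2
  ring

theorem idem_mul_self (c : ℤ) : idem r c * idem r c = idem r c := by
  have := r₁_cast_ne_zero r
  rw [idem_mul_idem]
  simp [this]

theorem idem_mul_idem_of_ne {c c' : ℕ} (hc : c < r₁ r) (hc' : c' < r₁ r) (h : c ≠ c') :
    idem r c * idem r c' = 0 := by
  rw [idem_mul_idem, sum_q_zpow, mul_zero, zero_smul]
  intro hd
  refine h ?_
  have := Int.eq_zero_of_abs_lt_dvd hd (by rw [abs_lt]; constructor <;> omega)
  omega

/-- Orthogonality of characters: after exchanging the sums only the power `K^0` survives. -/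
theorem sum_idem : ∑ c ∈ Finset.range (r₁ r), idem r c = 1 := by
  have h0 := r₁_cast_ne_zero r
  unfold idem
  rw [← Finset.smul_sum, Finset.sum_comm]
  simp_rw [← Finset.sum_smul]
  rw [Finset.sum_eq_single_of_mem 0 (Finset.mem_range.2 (r₁_pos r))]
  · simp [Kpow_zero, smul_smul, h0]
  · intro d hd hd0
    have hd' := Finset.mem_range.1 hd
    have := sum_q_zpow r (n := -(d : ℤ)) fun hdvd => by
      have := Int.le_of_dvd (by omega) ((dvd_neg).1 hdvd)
      omega
    rw [← zero_smul ℂ (Kpow r d), ← this]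
    congr 1
    refine Finset.sum_congr rfl fun c _ => ?_
    congr 1
    ring

theorem q_smul_idem_periodic (n m x : ℤ) :
    q r ^ (2 * n * (x + r₁ r + m) ^ 2) • idem r (x + r₁ r) =
      q r ^ (2 * n * (x + m) ^ 2) • idem r x := by
  rw [idem_add_r₁, q_zpow_congr r (m := 2 * n * (x + r₁ r + m) ^ 2)
    (n := 2 * n * (x + m) ^ 2) ⟨n * (2 * x + 2 * m + r₁ r), by ring⟩]

theorem gaussian_mul (m n : ℤ) : gaussian r m * gaussian r n = gaussian r (m + n) := by
  unfold gaussian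
  rw [Finset.sum_mul]
  refine Finset.sum_congr rfl fun c hc => ?_
  rw [Finset.mul_sum, Finset.sum_eq_single_of_mem c hc]
  · rw [smul_mul_smul_comm, idem_mul_self, ← zpow_add₀ (q_ne_zero r)]
    congr 2
    ring
  · intro c' hc' h
    rw [smul_mul_smul_comm,
      idem_mul_idem_of_ne r (Finset.mem_range.1 hc) (Finset.mem_range.1 hc') h.symm, smul_zero]

theorem gaussian_zero : gaussian r 0 = 1 := by
  simp [gaussian, sum_idem]

theorem Kpow_mul_gaussian (m n : ℤ) : Kpow r m * gaussian r n =
    ∑ c ∈ Finset.range (r₁ r), q r ^ (2 * n * (c : ℤ) ^ 2 + 2 * m * c) • idem r c := by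
  unfold gaussian
  rw [Finset.mul_sum]
  refine Finset.sum_congr rfl fun c _ => ?_
  rw [mul_smul_comm, Kpow_mul_idem, smul_smul, ← zpow_add₀ (q_ne_zero r)]

/-- Passing `E^a` shifts the eigenvalue index by `a`. In `(c + a)² = a² + 2ac + c²` the constant
gives the scalar and the cross term gives the power of `K`. -/
theorem gaussian_mul_E_pow (n : ℤ) (a : ℕ) : gaussian r n * E r ^ a =
    q r ^ (2 * n * (a : ℤ) ^ 2) • (E r ^ a * (Kpow r (2 * n * a) * gaussian r n)) := by
  rw [Kpow_mul_gaussian]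
  unfold gaussian
  rw [Finset.sum_mul, ← mul_smul_comm, Finset.smul_sum]
  simp_rw [smul_mul_assoc, idem_mul_E_pow, ← mul_smul_comm]
  rw [← Finset.mul_sum]
  congr 1
  have h := sum_range_periodic_add (N := r₁ r) (g := fun x => q r ^ (2 * n * (x + a) ^ 2) •
    idem r x) (fun x => q_smul_idem_periodic r n a x) (-a)
  simp only [← sub_eq_add_neg, sub_add_cancel] at h
  rw [h]
  refine Finset.sum_congr rfl fun c _ => ?_
  rw [smul_smul, ← zpow_add₀ (q_ne_zero r)]
  congr 2
  ring

theorem gaussian_mul_F (n : ℤ) : gaussian r n * F r =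
    q r ^ (2 * n) • (F r * (Kpow r (-2 * n) * gaussian r n)) := by
  rw [Kpow_mul_gaussian]
  unfold gaussian
  rw [Finset.sum_mul, ← mul_smul_comm, Finset.smul_sum]
  simp_rw [smul_mul_assoc, idem_mul_F, ← mul_smul_comm]
  rw [← Finset.mul_sum]
  congr 1
  have h := sum_range_periodic_add (N := r₁ r) (g := fun x => q r ^ (2 * n * (x + (-1)) ^ 2) •
    idem r x) (fun x => q_smul_idem_periodic r n (-1) x) 1
  simp only [add_neg_cancel_right] at h
  rw [h]
  refine Finset.sum_congr rfl fun c _ => ?_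
  rw [smul_smul, ← zpow_add₀ (q_ne_zero r)]
  congr 2
  ring

theorem gaussian_mul_E (n : ℤ) : gaussian r n * E r =
    q r ^ (2 * n) • (E r * (Kpow r (2 * n) * gaussian r n)) := by
  simpa using gaussian_mul_E_pow r n 1

/-- The right side is the Cartan part of the R-matrix after `S(R'')R'`; the substitution `d = b - c`
identifies the two. -/
theorem gaussian_neg_one_eq : gaussian r (-1) = (1 / (r₁ r : ℂ)) •
    ∑ b ∈ Finset.range (r₁ r), ∑ c ∈ Finset.range (r₁ r),
      q r ^ (-2 * (b : ℤ) * c) • Kpow r (b - c) := by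
  unfold gaussian idem
  rw [Finset.sum_comm, Finset.smul_sum]
  refine Finset.sum_congr rfl fun c _ => ?_
  rw [smul_comm]
  congr 1
  rw [← sum_range_periodic_add (N := r₁ r) (g := fun x => q r ^ (-2 * (c : ℤ) * x) • Kpow r x)
    (fun x => q_smul_Kpow_periodic r c x) (-c), Finset.smul_sum]
  refine Finset.sum_congr rfl fun b _ => ?_
  rw [smul_smul, ← zpow_add₀ (q_ne_zero r), ← sub_eq_add_neg]
  congr 2
  ring

end

/-! ### Closed forms of the ribbon element and of its inverse -/

theorem triangle_succ (a : ℕ) :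
    (((a + 1 : ℕ) : ℤ) + 3) * ((a + 1 : ℕ) : ℤ) / 2 = ((a : ℤ) + 3) * a / 2 + (a + 2) := by
  have h : (((a + 1 : ℕ) : ℤ) + 3) * ((a + 1 : ℕ) : ℤ) = ((a : ℤ) + 3) * a + (a + 2) * 2 := by
    push_cast; ring
  rw [h, Int.add_mul_ediv_right _ _ two_ne_zero]

theorem two_mul_triangle (a : ℕ) : 2 * (((a : ℤ) + 3) * a / 2) = ((a : ℤ) + 3) * a := by
  refine Int.mul_ediv_cancel' ?_
  rw [← even_iff_two_dvd]
  rcases Int.even_or_odd (a : ℤ) with h | h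
  · exact h.mul_left _
  · exact (h.add_odd (by decide)).mul_right _

/-- The coefficients of the ribbon element. -/
def coeffPos (r a : ℕ) : ℂ := brace r (-1) ^ a / qFact r a * q r ^ (-(((a : ℤ) + 3) * a / 2))

/-- The coefficients of the inverse of the ribbon element. -/
def coeffNeg (r a : ℕ) : ℂ := brace r 1 ^ a / qFact r a * q r ^ (((a : ℤ) + 3) * a / 2)

/-- A closed form of the ribbon element. -/
def ribbonPos (r : ℕ) : SmallQuantumSl2 r :=
  ∑ a ∈ Finset.range (r₁ r), coeffPos r a •
    (F r ^ a * E r ^ a * (Kpow r (-a - 1) * gaussian r (-1)))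

/-- A closed form of the inverse of the ribbon element. -/
def ribbonNeg (r : ℕ) : SmallQuantumSl2 r :=
  ∑ a ∈ Finset.range (r₁ r), coeffNeg r a •
    (F r ^ a * E r ^ a * (Kpow r (a + 1) * gaussian r 1))

theorem F_pow_r₁ (r : ℕ) : F r ^ r₁ r = 0 := gen_F_pow r

theorem E_pow_r₁ (r : ℕ) : E r ^ r₁ r = 0 := gen_E_pow r

theorem Kpow_mul_F_pow_mul_E_pow (r : ℕ) (m : ℤ) (a : ℕ) :
    Kpow r m * (F r ^ a * E r ^ a) = F r ^ a * E r ^ a * Kpow r m := by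
  rw [← mul_assoc, Kpow_mul_F_pow, smul_mul_assoc, mul_assoc (F r ^ a), Kpow_mul_E_pow,
    mul_smul_comm, smul_smul, ← zpow_add₀ (q_ne_zero r), mul_assoc (F r ^ a),
    show -2 * m * (a : ℤ) + 2 * m * a = 0 by ring, zpow_zero, one_smul]

theorem commute_ribbonPos_Kpow (r : ℕ) (m : ℤ) : Commute (ribbonPos r) (Kpow r m) := by
  refine Commute.sum_left _ _ _ fun a _ => Commute.smul_left (Commute.mul_left ?_ ?_) _
  · exact (Kpow_mul_F_pow_mul_E_pow r m a).symm
  · refine Commute.mul_left ?_ (commute_Kpow_gaussian r m (-1)).symm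
    rw [Commute, SemiconjBy, Kpow_mul, Kpow_mul, add_comm]

/-! ### Antipodes of monomials and the Drinfeld element. -/

theorem antipodeLin_pow (r : ℕ) (x : SmallQuantumSl2 r) (n : ℕ) :
    antipodeLin r (x ^ n) = antipodeLin r x ^ n := by
  induction n with
  | zero => simp [antipodeLin_one]
  | succ n ih => rw [pow_succ, antipodeLin_mul, ih, pow_succ']

theorem antipodeLin_Kpow (r n : ℕ) : antipodeLin r (Kpow r n) = Kpow r (-n) := by
  have h : ∀ n : ℕ, Kpow r n = gen r Gen.K ^ n := fun n => by simp [Kpow, K]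
  rw [h, antipodeLin_pow, (antipodeLin_gen r).1, ← Kpow_neg_one]
  simp [Kpow]

theorem K_mul_F_pow (r a : ℕ) :
    (gen r Gen.K * F r) ^ a = q r ^ (-((a : ℤ) * (a + 1))) • (F r ^ a * Kpow r a) := by
  induction a with
  | zero => simp [Kpow_zero]
  | succ a ih =>
    rw [pow_succ, ih, ← Kpow_one, smul_mul_assoc, mul_assoc, Kpow_mul_mul, Kpow_mul_F,
      mul_smul_comm, smul_smul, ← zpow_add₀ (q_ne_zero r), ← mul_assoc, ← pow_succ]
    congr 2
    push_cast
    ring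

theorem antipodeLin_F_pow (r a : ℕ) : antipodeLin r (F r ^ a) =
    ((-1) ^ a * q r ^ (-((a : ℤ) * (a + 1)))) • (F r ^ a * Kpow r a) := by
  have h : antipodeLin r (F r) = -(gen r Gen.K * F r) := (antipodeLin_gen r).2.2.2
  rw [antipodeLin_pow, h, neg_pow, K_mul_F_pow, mul_smul]
  rcases Nat.even_or_odd a with ha | ha <;> simp [ha]

section

variable (r : ℕ) [Fact (2 < r)]

theorem drinfeldElement_rMatrix : drinfeldElement (rMatrix r) =
    ∑ a ∈ Finset.range (r₁ r), coeffPos r a •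
      (F r ^ a * E r ^ a * (Kpow r (-a) * gaussian r (-1))) := by
  have hS : ∀ x, (HopfAlgebra.antipode ℂ : SmallQuantumSl2 r →ₗ[ℂ] _) x = antipodeLin r x :=
    fun _ => rfl
  have hK : ∀ n : ℕ, ((K r ^ n : (SmallQuantumSl2 r)ˣ) : SmallQuantumSl2 r) = Kpow r n :=
    fun n => by simp [Kpow]
  unfold drinfeldElement rMatrix
  simp only [map_smul, map_sum, TensorProduct.comm_tmul, LinearMap.rTensor_tmul,
    LinearMap.mul'_apply, hS, hK, antipodeLin_mul, antipodeLin_Kpow]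
  rw [Finset.smul_sum]
  refine Finset.sum_congr rfl fun a _ => ?_
  -- In `S(K^c F^a) K^b E^a` the powers of `K` stand between `F^a` and `E^a`, so the Gaussian is
  -- moved there before being expanded.
  have h1 : F r ^ a * E r ^ a * (Kpow r (-a) * gaussian r (-1)) =
      F r ^ a * Kpow r a * gaussian r (-1) * E r ^ a := by
    rw [mul_assoc _ _ (E r ^ a), gaussian_mul_E_pow, mul_smul_comm, mul_assoc _ (Kpow r a),
      ← mul_assoc (Kpow r a), Kpow_mul_E_pow, smul_mul_assoc, mul_smul_comm, smul_smul,
      ← zpow_add₀ (q_ne_zero r), mul_assoc (E r ^ a), Kpow_mul_mul, mul_assoc]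
    rw [show 2 * -1 * (a : ℤ) ^ 2 + 2 * a * a = 0 by ring, zpow_zero, one_smul]
    congr 4
    ring
  rw [h1, gaussian_neg_one_eq]
  simp only [mul_smul_comm, smul_mul_assoc, Finset.mul_sum, Finset.sum_mul, Finset.smul_sum,
    smul_smul]
  refine Finset.sum_congr rfl fun b _ => Finset.sum_congr rfl fun c _ => ?_
  rw [antipodeLin_F_pow, smul_mul_assoc, smul_mul_assoc, smul_smul]
  congr 1
  · have h2 : (a : ℤ) * (a - 1) / 2 = ((a : ℤ) + 3) * a / 2 - 2 * a := by
      rw [show (a : ℤ) * (a - 1) = (a + 3) * a + (-2 * a) * 2 by ring,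
        Int.add_mul_ediv_right _ _ two_ne_zero]
      ring
    have h3 := two_mul_triangle a
    have h4 : q r ^ ((a : ℤ) * (a - 1) / 2 - 2 * b * c) * q r ^ (-((a : ℤ) * (a + 1))) =
        q r ^ (-(((a : ℤ) + 3) * a / 2)) * q r ^ (-2 * (b : ℤ) * c) := by
      rw [← zpow_add₀ (q_ne_zero r), ← zpow_add₀ (q_ne_zero r), h2]
      congr 1
      linarith
    rw [coeffPos, brace_neg_one, neg_pow]
    linear_combination (1 / (r₁ r : ℂ) * (brace r 1 ^ a / qFact r a) * (-1) ^ a) * h4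
  · rw [← mul_assoc, mul_assoc _ (Kpow r (-c)), Kpow_mul]
    congr 3
    ring

theorem ribbonElement_eq : ribbonElement r = ribbonPos r := by
  have h : (((pivotal r)⁻¹ : (SmallQuantumSl2 r)ˣ) : SmallQuantumSl2 r) = Kpow r (-1) := by
    simp [Kpow, pivotal]
  rw [ribbonElement, h, drinfeldElement_rMatrix, ribbonPos, Finset.mul_sum]
  refine Finset.sum_congr rfl fun a _ => ?_
  rw [mul_smul_comm, ← mul_assoc (Kpow r (-1)), Kpow_mul_F_pow_mul_E_pow, mul_assoc _ (Kpow r (-1)),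
    Kpow_mul_mul, neg_add_eq_sub]

/-! ### Centrality of the ribbon element. -/

theorem coeffPos_succ {a : ℕ} (ha : a + 1 < r₁ r) :
    coeffPos r (a + 1) * (qInt r ((a + 1 : ℕ) : ℤ) / brace r 1) =
      -coeffPos r a * q r ^ (-((a : ℤ) + 2)) := by
  have h1 := qInt_ne_zero r (Nat.succ_pos a) ha
  have h2 := brace_one_ne_zero r
  rw [coeffPos, coeffPos, triangle_succ, qFact_succ, brace_neg_one, neg_add, zpow_add₀ (q_ne_zero r),
    pow_succ]
  field_simp

theorem commute_ribbonPos_F : Commute (ribbonPos r) (F r) := by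
  have hq := q_ne_zero r
  obtain ⟨M, hM⟩ : ∃ M, r₁ r = M + 1 := ⟨r₁ r - 1, by have := r₁_pos r; omega⟩
  -- Here `G a` is `F` times the term of index `a`, and `H a` is that term times `F` with the
  -- commutator correction left out. The correction at index `a + 1` is `G a - H a` by
  -- `coeffPos_succ`, so the `H` parts telescope. Both vanish at `M = r' - 1` because they contain
  -- `F^r'`.
  let G : ℕ → SmallQuantumSl2 r := fun a =>
    coeffPos r a • (F r ^ (a + 1) * E r ^ a * (Kpow r (-a - 1) * gaussian r (-1)))
  let H : ℕ → SmallQuantumSl2 r := fun a =>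
    (coeffPos r a * q r ^ (2 * (a : ℤ))) •
      (F r ^ (a + 1) * E r ^ a * (Kpow r (1 - a) * gaussian r (-1)))
  have hGM : G M = 0 := by
    simp only [G]; rw [← hM, F_pow_r₁, zero_mul, zero_mul, smul_zero]
  have hHM : H M = 0 := by
    simp only [H]; rw [← hM, F_pow_r₁, zero_mul, zero_mul, smul_zero]
  have hleft : F r * ribbonPos r = ∑ a ∈ Finset.range (r₁ r), G a := by
    rw [ribbonPos, Finset.mul_sum]
    refine Finset.sum_congr rfl fun a _ => ?_
    rw [mul_smul_comm, ← mul_assoc (F r), ← mul_assoc (F r) (F r ^ a), ← pow_succ']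
  have hT : ∀ a : ℕ, Kpow r (-a - 1) * gaussian r (-1) * F r =
      q r ^ (2 * (a : ℤ)) • (F r * (Kpow r (1 - a) * gaussian r (-1))) := by
    intro a
    rw [mul_assoc, gaussian_mul_F, mul_smul_comm, ← mul_assoc, Kpow_mul_F, smul_mul_assoc,
      smul_smul, ← zpow_add₀ hq, mul_assoc, Kpow_mul_mul,
      show -(a : ℤ) - 1 + -2 * -1 = 1 - a by ring]
    congr 2
    ring
  have hzero : coeffPos r 0 •
      (F r ^ 0 * E r ^ 0 * (Kpow r (-(0 : ℕ) - 1) * gaussian r (-1))) * F r = H 0 := by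
    rw [smul_mul_assoc, mul_assoc, hT]
    simp [H]
  have hsucc : ∀ a < M, coeffPos r (a + 1) • (F r ^ (a + 1) * E r ^ (a + 1) *
      (Kpow r (-(a + 1 : ℕ) - 1) * gaussian r (-1))) * F r = H (a + 1) + (G a - H a) := by
    intro a ha
    have hc := coeffPos_succ r (a := a) (by omega)
    rw [smul_mul_assoc, mul_assoc, hT, mul_smul_comm, smul_smul, mul_assoc (F r ^ (a + 1)),
      ← mul_assoc (E r ^ (a + 1)), E_pow_succ_mul_F, add_mul, mul_add, smul_add]
    congr 1
    · simp only [H]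
      rw [pow_succ (F r) (a + 1)]
      simp only [mul_assoc]
    · simp only [G, H]
      rw [smul_mul_assoc, mul_smul_comm, smul_smul, mul_right_comm, hc, mul_assoc (E r ^ a),
        sub_mul, smul_mul_assoc, smul_mul_assoc, Kpow_mul_mul, Kpow_mul_mul]
      simp only [mul_sub, smul_sub, mul_smul_comm, smul_smul, mul_assoc (F r ^ (a + 1))]
      rw [show 1 + (1 - ((a + 1 : ℕ) : ℤ)) = 1 - a by push_cast; ring,
        show -1 + (1 - ((a + 1 : ℕ) : ℤ)) = -a - 1 by push_cast; ring]
      have e1 : -coeffPos r a * q r ^ (-((a : ℤ) + 2)) * q r ^ (2 * ((a + 1 : ℕ) : ℤ)) *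
          q r ^ (a : ℤ) = -(coeffPos r a * q r ^ (2 * (a : ℤ))) := by
        rw [mul_assoc, mul_assoc, ← zpow_add₀ hq, ← zpow_add₀ hq, neg_mul]
        congr 3
        push_cast
        ring
      have e2 : -coeffPos r a * q r ^ (-((a : ℤ) + 2)) * q r ^ (2 * ((a + 1 : ℕ) : ℤ)) *
          q r ^ (-(a : ℤ)) = -coeffPos r a := by
        rw [mul_assoc, mul_assoc, ← zpow_add₀ hq, ← zpow_add₀ hq,
          show -((a : ℤ) + 2) + (2 * ((a + 1 : ℕ) : ℤ) + -(a : ℤ)) = 0 by push_cast; ring,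
          zpow_zero, mul_one]
      rw [e1, e2, neg_smul, neg_smul]
      abel
  rw [Commute, SemiconjBy, hleft, ribbonPos, Finset.sum_mul, hM, Finset.sum_range_succ', hzero,
    Finset.sum_congr rfl fun a ha => hsucc a (Finset.mem_range.1 ha), Finset.sum_range_succ, hGM,
    Finset.sum_add_distrib, Finset.sum_sub_distrib]
  have h := Finset.sum_range_succ H M
  rw [Finset.sum_range_succ', hHM, add_zero] at h
  rw [← h]
  abel

/-- The same telescoping with sides exchanged: the corrections now arise from moving `E` through
`F^(a+1)` on the left, and the boundary terms contain `E^r'`. -/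
theorem commute_ribbonPos_E : Commute (ribbonPos r) (E r) := by
  have hq := q_ne_zero r
  obtain ⟨M, hM⟩ : ∃ M, r₁ r = M + 1 := ⟨r₁ r - 1, by have := r₁_pos r; omega⟩
  let G : ℕ → SmallQuantumSl2 r := fun a =>
    coeffPos r a • (F r ^ a * E r ^ (a + 1) * (Kpow r (-a - 1) * gaussian r (-1)))
  let H : ℕ → SmallQuantumSl2 r := fun a =>
    (coeffPos r a * q r ^ (-2 * (a : ℤ) - 4)) •
      (F r ^ a * E r ^ (a + 1) * (Kpow r (-a - 3) * gaussian r (-1)))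
  have hGM : G M = 0 := by
    simp only [G]; rw [← hM, E_pow_r₁, mul_zero, zero_mul, smul_zero]
  have hHM : H M = 0 := by
    simp only [H]; rw [← hM, E_pow_r₁, mul_zero, zero_mul, smul_zero]
  have hright : ribbonPos r * E r = ∑ a ∈ Finset.range (r₁ r), H a := by
    rw [ribbonPos, Finset.sum_mul]
    refine Finset.sum_congr rfl fun a _ => ?_
    simp only [H]
    rw [smul_mul_assoc, mul_assoc, mul_assoc (Kpow r _), gaussian_mul_E, mul_smul_comm,
      ← mul_assoc (Kpow r _), Kpow_mul_E, smul_mul_assoc, smul_smul, ← zpow_add₀ hq, mul_assoc (E r),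
      Kpow_mul_mul, mul_smul_comm, smul_smul, ← mul_assoc _ (E r), mul_assoc _ (E r ^ a), ← pow_succ,
      show -(a : ℤ) - 1 + 2 * -1 = -a - 3 by ring]
    congr 3
    ring
  have hzero : E r * coeffPos r 0 •
      (F r ^ 0 * E r ^ 0 * (Kpow r (-(0 : ℕ) - 1) * gaussian r (-1))) = G 0 := by
    simp [G]
  have hsucc : ∀ a < M, E r * coeffPos r (a + 1) • (F r ^ (a + 1) * E r ^ (a + 1) *
      (Kpow r (-(a + 1 : ℕ) - 1) * gaussian r (-1))) = G (a + 1) + (H a - G a) := by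
    intro a ha
    have hc := coeffPos_succ r (a := a) (by omega)
    rw [mul_smul_comm, ← mul_assoc, ← mul_assoc (E r), E_mul_F_pow_succ, add_mul, add_mul, smul_add]
    congr 1
    · simp only [G]
      rw [mul_assoc _ (E r), ← pow_succ']
    · simp only [G, H]
      rw [smul_mul_assoc, smul_mul_assoc, smul_smul, hc, mul_assoc (F r ^ a), sub_mul,
        smul_mul_assoc, smul_mul_assoc, Kpow_mul_E_pow, Kpow_mul_E_pow, mul_assoc (F r ^ a), sub_mul]
      simp only [mul_sub, smul_sub, smul_mul_assoc, mul_smul_comm, smul_smul, mul_assoc,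
        Kpow_mul_mul]
      rw [show 1 + (-((a + 1 : ℕ) : ℤ) - 1) = -a - 1 by push_cast; ring,
        show -1 + (-((a + 1 : ℕ) : ℤ) - 1) = -a - 3 by push_cast; ring]
      have e1 : -coeffPos r a * (q r ^ (-((a : ℤ) + 2)) * (q r ^ (-(a : ℤ)) *
          q r ^ (2 * (1 * ((a + 1 : ℕ) : ℤ))))) = -coeffPos r a := by
        rw [← zpow_add₀ hq, ← zpow_add₀ hq,
          show -((a : ℤ) + 2) + (-a + 2 * (1 * ((a + 1 : ℕ) : ℤ))) = 0 by push_cast; ring,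
          zpow_zero, mul_one]
      have e2 : -coeffPos r a * (q r ^ (-((a : ℤ) + 2)) * (q r ^ (a : ℤ) *
          q r ^ (2 * (-1 * ((a + 1 : ℕ) : ℤ))))) = -(coeffPos r a * q r ^ (-2 * (a : ℤ) - 4)) := by
        rw [← zpow_add₀ hq, ← zpow_add₀ hq, neg_mul]
        congr 3
        push_cast
        ring
      rw [e1, e2, neg_smul, neg_smul]
      abel
  rw [Commute, SemiconjBy, hright, ribbonPos, Finset.mul_sum, hM, Finset.sum_range_succ' (fun a => E r * _), hzero,
    Finset.sum_congr rfl fun a ha => hsucc a (Finset.mem_range.1 ha), Finset.sum_range_succ, hHM,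
    Finset.sum_add_distrib, Finset.sum_sub_distrib]
  have h := Finset.sum_range_succ G M
  rw [Finset.sum_range_succ', hGM, add_zero] at h
  rw [← h]
  abel

/-! ### The inverse of the ribbon element. -/

theorem commute_ribbonPos_ribbonNeg : Commute (ribbonPos r) (ribbonNeg r) := by
  refine Commute.sum_right _ _ _ fun a _ => Commute.smul_right (Commute.mul_right
    (((commute_ribbonPos_F r).pow_right a).mul_right ((commute_ribbonPos_E r).pow_right a))
    ((commute_ribbonPos_Kpow r _).mul_right ?_)) _
  unfold gaussian idem
  exact Commute.sum_right _ _ _ fun c _ => (Commute.smul_right (Commute.smul_right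
    (Commute.sum_right _ _ _ fun d _ => Commute.smul_right (commute_ribbonPos_Kpow r _) _) _) _)

/-- Multiply by `[n+1]`, which is nonzero below `r'`, and split it as `q^b [a] + q^(-a) [b]` with `a
+ b = n + 1`. Each half lowers one of the factorials, and the two resulting sums over `a + b = n`
cancel term by term. -/
theorem sum_antidiagonal_qFact {n : ℕ} (hn : n + 1 < r₁ r) :
    ∑ x ∈ Finset.HasAntidiagonal.antidiagonal (n + 1), (-1) ^ x.1 * q r ^ ((x.1 : ℤ) * (1 - (n + 1 : ℕ))) /
      (qFact r x.1 * qFact r x.2) = 0 := by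
  have hq := q_ne_zero r
  have h0 := qInt_ne_zero r (Nat.succ_pos n) hn
  refine (mul_eq_zero.1 ?_).resolve_left h0
  rw [Finset.mul_sum]
  have h1 : ∀ x ∈ Finset.HasAntidiagonal.antidiagonal (n + 1), qInt r ((n + 1 : ℕ) : ℤ) *
      ((-1) ^ x.1 * q r ^ ((x.1 : ℤ) * (1 - (n + 1 : ℕ))) / (qFact r x.1 * qFact r x.2)) =
      q r ^ (x.2 : ℤ) * qInt r x.1 * ((-1) ^ x.1 * q r ^ ((x.1 : ℤ) * (1 - (n + 1 : ℕ))) /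
        (qFact r x.1 * qFact r x.2)) +
      q r ^ (-(x.1 : ℤ)) * qInt r x.2 * ((-1) ^ x.1 * q r ^ ((x.1 : ℤ) * (1 - (n + 1 : ℕ))) /
        (qFact r x.1 * qFact r x.2)) := by
    intro x hx
    rw [← add_mul, ← qInt_add, ← Nat.cast_add, Finset.HasAntidiagonal.mem_antidiagonal.1 hx]
  -- The end terms dropped here carry the factor `[0] = 0`: `a = 0` in the first sum and `b = 0` in
  -- the second.
  rw [Finset.sum_congr rfl h1, Finset.sum_add_distrib, Finset.Nat.antidiagonal_succ,
    Finset.sum_cons, Finset.sum_map, ← Finset.Nat.antidiagonal_succ, Finset.Nat.antidiagonal_succ',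
    Finset.sum_cons, Finset.sum_map]
  simp only [Nat.cast_zero, qInt_zero, mul_zero, zero_mul, zero_add, Function.Embedding.prodMap,
    Function.Embedding.coeFn_mk, Prod.map, Function.Embedding.refl_apply, Nat.succ_eq_add_one]
  rw [← Finset.sum_add_distrib]
  refine Finset.sum_eq_zero fun x hx => ?_
  have hx' := Finset.HasAntidiagonal.mem_antidiagonal.1 hx
  have h2 := qInt_ne_zero r (Nat.succ_pos x.1) (by omega)
  have h3 := qInt_ne_zero r (Nat.succ_pos x.2) (by omega)
  have h4 : q r ^ (x.2 : ℤ) * q r ^ (((x.1 + 1 : ℕ) : ℤ) * (1 - (n + 1 : ℕ))) =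
      q r ^ (-(x.1 : ℤ)) * q r ^ ((x.1 : ℤ) * (1 - (n + 1 : ℕ))) := by
    rw [← zpow_add₀ hq, ← zpow_add₀ hq, ← hx']
    congr 1
    push_cast
    ring
  have h5 : qInt r ((x.1 + 1 : ℕ) : ℤ) / qFact r (x.1 + 1) = 1 / qFact r x.1 := by
    rw [qFact_succ, mul_comm, div_mul_cancel_left₀ h2, one_div]
  have h6 : qInt r ((x.2 + 1 : ℕ) : ℤ) / qFact r (x.2 + 1) = 1 / qFact r x.2 := by
    rw [qFact_succ, mul_comm, div_mul_cancel_left₀ h3, one_div]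
  linear_combination (-(-1) ^ x.1 * q r ^ (x.2 : ℤ) *
      q r ^ (((x.1 + 1 : ℕ) : ℤ) * (1 - (n + 1 : ℕ))) / qFact r x.2) * h5 +
    ((-1) ^ x.1 * q r ^ (-(x.1 : ℤ)) * q r ^ ((x.1 : ℤ) * (1 - (n + 1 : ℕ))) / qFact r x.1) * h6 +
    (-(-1) ^ x.1 / (qFact r x.1 * qFact r x.2)) * h4

theorem ribbonPos_mul_ribbonNeg : ribbonPos r * ribbonNeg r = 1 := by
  have hq := q_ne_zero r
  let W : ℕ → SmallQuantumSl2 r := fun n => F r ^ n * E r ^ n * Kpow r (-n)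
  have hW : ∀ n, r₁ r ≤ n → W n = 0 := by
    intro n hn
    obtain ⟨m, rfl⟩ := Nat.exists_eq_add_of_le hn
    simp only [W]
    rw [pow_add, F_pow_r₁, zero_mul, zero_mul, zero_mul]
  let x : ℕ → ℕ → ℂ := fun a b =>
    coeffNeg r a * coeffPos r b * q r ^ (-2 * (a : ℤ) ^ 2 - 2 * a * (b + 1))
  have h1 : ribbonPos r * ribbonNeg r =
      ∑ a ∈ Finset.range (r₁ r), ∑ b ∈ Finset.range (r₁ r), x a b • W (a + b) := by
    rw [ribbonNeg, Finset.mul_sum]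
    refine Finset.sum_congr rfl fun a _ => ?_
    -- Centrality places `v₊` between `F^a` and `E^a`, so that powers of `F` meet on the left and
    -- powers of `E` on the right, while `G (-1)` and `G 1` cancel.
    rw [mul_smul_comm, ← mul_assoc, ← mul_assoc (ribbonPos r), ((commute_ribbonPos_F r).pow_right a).eq, ribbonPos]
    simp only [Finset.mul_sum, Finset.sum_mul, Finset.smul_sum]
    refine Finset.sum_congr rfl fun b _ => ?_
    have hT : gaussian r (-1) * (Kpow r (a + 1) * gaussian r 1) = Kpow r (a + 1) := by
      rw [← mul_assoc, ← (commute_Kpow_gaussian r _ _).eq, mul_assoc, gaussian_mul, neg_add_cancel,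
        gaussian_zero, mul_one]
    have hW' : F r ^ a * (F r ^ b * E r ^ b * (Kpow r (-b - 1) * gaussian r (-1))) * E r ^ a *
        (Kpow r (a + 1) * gaussian r 1) = q r ^ (-2 * (a : ℤ) ^ 2 - 2 * a * (b + 1)) • W (a + b) := by
      calc _ = F r ^ (a + b) * E r ^ b * Kpow r (-b - 1) * (gaussian r (-1) * E r ^ a) *
              (Kpow r (a + 1) * gaussian r 1) := by
            rw [pow_add]; simp only [mul_assoc]
        _ = q r ^ (2 * -1 * (a : ℤ) ^ 2) • (F r ^ (a + b) * E r ^ b * (Kpow r (-b - 1) * E r ^ a) *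
              Kpow r (2 * -1 * a) * (gaussian r (-1) * (Kpow r (a + 1) * gaussian r 1))) := by
            rw [gaussian_mul_E_pow]; simp only [mul_assoc, mul_smul_comm, smul_mul_assoc]
        _ = _ := by
            rw [hT, Kpow_mul_E_pow]
            simp only [mul_smul_comm, smul_mul_assoc, smul_smul, ← zpow_add₀ hq, mul_assoc,
              Kpow_mul]
            simp only [W, ← mul_assoc]
            rw [mul_assoc _ (E r ^ b) (E r ^ a), ← pow_add, add_comm b a]
            congr 3
            · ring
            · push_cast
              ring
    rw [mul_smul_comm, smul_mul_assoc, smul_mul_assoc, hW', smul_smul, smul_smul]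
  -- Nilpotency cuts the square down to the triangle `a + b < r'`, which can be summed along
  -- antidiagonals.
  have h2 : ∀ a ∈ Finset.range (r₁ r), ∑ b ∈ Finset.range (r₁ r), x a b • W (a + b) =
      ∑ b ∈ Finset.range (r₁ r - a), x a b • W (a + b) := by
    intro a _
    refine (Finset.sum_subset (Finset.range_subset_range.2 (Nat.sub_le _ _)) fun b _ hb => ?_).symm
    rw [Finset.mem_range, not_lt] at hb
    rw [hW _ (by omega), smul_zero]
  have h3 : ∀ n ∈ Finset.range (r₁ r), ∑ k ∈ Finset.range (n + 1), x k (n - k) • W (k + (n - k)) =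
      (∑ y ∈ Finset.HasAntidiagonal.antidiagonal n, x y.1 y.2) • W n := by
    intro n _
    rw [Finset.Nat.sum_antidiagonal_eq_sum_range_succ x, Finset.sum_smul]
    refine Finset.sum_congr rfl fun k hk => ?_
    rw [Nat.add_sub_cancel' (Nat.lt_succ_iff.1 (Finset.mem_range.1 hk))]
  rw [h1, Finset.sum_congr rfl h2,
    ← Finset.sum_range_diag_flip (r₁ r) fun a b => x a b • W (a + b), Finset.sum_congr rfl h3,
    Finset.sum_eq_single_of_mem 0 (Finset.mem_range.2 (r₁_pos r))]
  · simp [x, W, coeffNeg, coeffPos, qFact, Kpow_zero]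
  · intro n hn hn0
    obtain ⟨m, rfl⟩ := Nat.exists_eq_succ_of_ne_zero hn0
    have h4 := sum_antidiagonal_qFact r (Finset.mem_range.1 hn)
    rw [show ∑ y ∈ Finset.HasAntidiagonal.antidiagonal (m + 1), x y.1 y.2 = 0 from ?_, zero_smul]
    rw [← mul_zero ((-brace r 1) ^ (m + 1) * q r ^ (-((((m + 1 : ℕ) : ℤ) + 3) * (m + 1 : ℕ) / 2))),
      ← h4, Finset.mul_sum]
    refine Finset.sum_congr rfl fun y hy => ?_
    rw [← Finset.HasAntidiagonal.mem_antidiagonal.1 hy]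
    obtain ⟨a, b⟩ := y
    have h5 : (((a : ℤ) + 3) * a / 2) + (-(((b : ℤ) + 3) * b / 2)) +
        (-2 * (a : ℤ) ^ 2 - 2 * a * (b + 1)) =
        -((((a + b : ℕ) : ℤ) + 3) * (a + b : ℕ) / 2) + (a : ℤ) * (1 - (a + b : ℕ)) := by
      refine mul_left_cancel₀ (two_ne_zero (α := ℤ)) ?_
      have e1 := two_mul_triangle a
      have e2 := two_mul_triangle b
      have e3 := two_mul_triangle (a + b)
      push_cast at *
      linear_combination e1 - e2 + e3
    have h6 := congrArg (fun z => q r ^ z) h5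
    simp only [zpow_add₀ hq] at h6
    have h7 : ((-1 : ℂ) ^ a) * (-1) ^ a = 1 := by rw [← mul_pow]; simp
    simp only [x, coeffNeg, coeffPos, brace_neg_one]
    rw [neg_pow (brace r 1) b, neg_pow (brace r 1) (a + b), pow_add, pow_add]
    linear_combination (brace r 1 ^ a * brace r 1 ^ b * (-1) ^ b / (qFact r a * qFact r b)) * h6 -
      (brace r 1 ^ a * brace r 1 ^ b * (-1) ^ b / (qFact r a * qFact r b) *
        (q r ^ (-((((a + b : ℕ) : ℤ) + 3) * (a + b : ℕ) / 2)) *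
          q r ^ ((a : ℤ) * (1 - (a + b : ℕ))))) * h7

end

/-! ### Expansion of the Gaussian elements in powers of `K` -/

theorem sum_range_two_mul {M : Type*} [AddCommMonoid M] (g : ℕ → M) (n : ℕ) :
    ∑ i ∈ Finset.range (2 * n), g i =
      ∑ i ∈ Finset.range n, g (2 * i) + ∑ i ∈ Finset.range n, g (2 * i + 1) := by
  induction n with
  | zero => simp
  | succ n ih =>
    rw [show 2 * (n + 1) = 2 * n + 1 + 1 by ring, Finset.sum_range_succ, Finset.sum_range_succ, ih,
      Finset.sum_range_succ, Finset.sum_range_succ]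
    abel

theorem sum_range_mul {M : Type*} [AddCommMonoid M] (g : ℕ → M) (t s : ℕ) :
    ∑ i ∈ Finset.range (t * s), g i =
      ∑ b ∈ Finset.range s, ∑ m ∈ Finset.range t, g (t * b + m) := by
  induction s with
  | zero => simp
  | succ s ih => rw [mul_add, mul_one, Finset.sum_range_add, ih, Finset.sum_range_succ]

theorem q_zpow_eq_exp (r : ℕ) (n : ℤ) :
    q r ^ n = Complex.exp (2 * Real.pi * Complex.I * n / r) := by
  rw [q, ← Complex.exp_int_mul]
  congr 1
  ring

theorem conj_q_zpow (r : ℕ) (n : ℤ) : (starRingEnd ℂ) (q r ^ n) = q r ^ (-n) := by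
  rw [q_zpow_eq_exp, q_zpow_eq_exp, ← Complex.exp_conj]
  congr 1
  simp only [map_div₀, map_mul, Complex.conj_I, Complex.conj_ofReal, map_ofNat, map_intCast,
    map_natCast, Int.cast_neg]
  ring

theorem conj_I_zpow (n : ℤ) : (starRingEnd ℂ) (Complex.I ^ n) = Complex.I ^ (-n) := by
  rw [map_zpow₀, Complex.conj_I, ← Complex.inv_I, inv_zpow, zpow_neg]

/-- Complex conjugation yields the Gauss sum needed for `v₊` from the one for `v₋`. -/
theorem sum_q_zpow_neg {r N : ℕ} {e : ℤ} {z : ℂ}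
    (h : ∑ c ∈ Finset.range N, q r ^ (e * (c : ℤ) ^ 2) = √(N : ℝ) * z) :
    ∑ c ∈ Finset.range N, q r ^ (-e * (c : ℤ) ^ 2) = √(N : ℝ) * (starRingEnd ℂ) z := by
  have h1 := congrArg (starRingEnd ℂ) h
  rw [map_sum, map_mul, Complex.conj_ofReal] at h1
  simp only [conj_q_zpow] at h1
  rw [← h1]
  refine Finset.sum_congr rfl fun c _ => ?_
  rw [neg_mul]

theorem sqrt_mul_div_self {N : ℕ} (hN : 0 < N) (z : ℂ) :
    1 / (N : ℂ) * (√(N : ℝ) * z) = z / √(N : ℝ) := by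
  have h1 : (√(N : ℝ) : ℂ) ^ 2 = N := by
    rw [← Complex.ofReal_pow, Real.sq_sqrt (Nat.cast_nonneg N)]; simp
  have h2 : (N : ℂ) ≠ 0 := by exact_mod_cast hN.ne'
  have h3 : (√(N : ℝ) : ℂ) ≠ 0 := by
    intro h0; rw [h0] at h1; exact h2 (by rw [← h1]; simp)
  rw [← h1]
  field_simp

section

variable (r : ℕ)

/-- The Fourier coefficients of the Gaussian elements. -/
def gaussianCoeff (n d : ℤ) : ℂ :=
  1 / (r₁ r : ℂ) * ∑ c ∈ Finset.range (r₁ r), q r ^ (2 * n * (c : ℤ) ^ 2 - 2 * c * d)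

theorem gaussian_eq_sum (n : ℤ) :
    gaussian r n = ∑ d ∈ Finset.range (r₁ r), gaussianCoeff r n d • Kpow r d := by
  unfold gaussian idem gaussianCoeff
  simp only [Finset.smul_sum, Finset.mul_sum, Finset.sum_smul, smul_smul]
  rw [Finset.sum_comm]
  refine Finset.sum_congr rfl fun d _ => Finset.sum_congr rfl fun c _ => ?_
  rw [sub_eq_add_neg, zpow_add₀ (q_ne_zero r)]
  congr 1
  rw [show -2 * (c : ℤ) * d = -(2 * c * d) by ring]
  ring

variable [Fact (2 < r)]

theorem q_pow_r : q r ^ (r : ℤ) = 1 := by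
  have h : 2 < r := Fact.out
  rw [zpow_natCast]
  exact (Complex.isPrimitiveRoot_exp r (by omega)).pow_eq_one

theorem q_zpow_eq_of_dvd {m n : ℤ} (h : (r : ℤ) ∣ m - n) : q r ^ m = q r ^ n := by
  obtain ⟨x, hx⟩ := h
  rw [show m = r * x + n by linarith, zpow_add₀ (q_ne_zero r), zpow_mul, q_pow_r, one_zpow, one_mul]

theorem gaussianCoeff_add_r₁ (n d : ℤ) : gaussianCoeff r n (d + r₁ r) = gaussianCoeff r n d := by
  unfold gaussianCoeff
  congr 1
  refine Finset.sum_congr rfl fun c _ => q_zpow_congr r ⟨-c, by ring⟩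

theorem gaussian_eq_sum_add (n m : ℤ) : gaussian r n =
    ∑ d ∈ Finset.range (r₁ r), gaussianCoeff r n (d + m) • Kpow r (d + m) := by
  rw [gaussian_eq_sum, ← sum_range_periodic_add (N := r₁ r)
    (g := fun x => gaussianCoeff r n x • Kpow r x) (fun x => by
      rw [gaussianCoeff_add_r₁, Kpow_add_r₁]) m]

/-- Complete the square with `h`, an inverse of 2 modulo `r'`: the shift is `c ↦ c - σhd`. The sign
`σ = ±1` is its own inverse, which treats `v₊` and `v₋` together. -/
theorem gaussianCoeff_of_odd {h : ℤ} (hh : (r₁ r : ℤ) = 2 * h - 1) {σ : ℤ} (hσ : σ * σ = 1) (d : ℤ) :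
    gaussianCoeff r σ d = 1 / (r₁ r : ℂ) *
      (∑ c ∈ Finset.range (r₁ r), q r ^ (2 * σ * (c : ℤ) ^ 2)) * q r ^ (-(2 * σ * h ^ 2) * d ^ 2) := by
  rw [gaussianCoeff, mul_assoc, Finset.sum_mul,
    ← sum_range_periodic_add (N := r₁ r)
      (g := fun x => q r ^ (2 * σ * x ^ 2) * q r ^ (-(2 * σ * h ^ 2) * d ^ 2)) (fun x => by
      rw [q_zpow_congr r (m := 2 * σ * (x + r₁ r) ^ 2) (n := 2 * σ * x ^ 2)
        ⟨σ * (2 * x + r₁ r), by ring⟩]) (-(σ * h * d))]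
  congr 1
  refine Finset.sum_congr rfl fun c _ => ?_
  rw [← zpow_add₀ (q_ne_zero r)]
  refine q_zpow_congr r ⟨c * d, ?_⟩
  rw [hh]
  linear_combination (-(2 * σ * h ^ 2 * d ^ 2) + 4 * c * h * d) * hσ

/-- Shifting `c` by the half-period `P` multiplies every term by `q^(2P(σP - d)) = (-1)^(σP - d) =
-1`, so the sum equals its negative. -/
theorem gaussianCoeff_eq_zero {P : ℕ} (hP : r₁ r = 2 * P) {σ d : ℤ} (hd : Odd (σ * P - d)) :
    gaussianCoeff r σ d = 0 := by
  have hP0 : 0 < P := by have := r₁_pos r; omega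
  have hP1 : q r ^ (2 * (P : ℤ)) = -1 := by
    have h1 : q r ^ (2 * (P : ℤ)) ≠ 1 := q_zpow_two_mul_ne_one r fun h => by
      have := Int.le_of_dvd (by omega) h
      omega
    have h2 : q r ^ (2 * (P : ℤ)) * q r ^ (2 * (P : ℤ)) = 1 := by
      rw [← zpow_add₀ (q_ne_zero r), ← q_pow_two_r₁ r, hP]
      congr 1
      push_cast
      ring
    exact (mul_self_eq_one_iff.1 h2).resolve_left h1
  have h := sum_range_periodic_add (N := r₁ r) (g := fun x => q r ^ (2 * σ * x ^ 2 - 2 * x * d))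
    (fun x => q_zpow_congr r ⟨σ * (2 * x + r₁ r) - d, by ring⟩) P
  have h3 : ∀ x : ℤ, q r ^ (2 * σ * (x + P) ^ 2 - 2 * (x + P) * d) =
      -q r ^ (2 * σ * x ^ 2 - 2 * x * d) := by
    intro x
    have h4 : q r ^ (2 * (P : ℤ) * (σ * P - d)) = -1 := by
      rw [zpow_mul, hP1, hd.neg_one_zpow]
    rw [← neg_one_mul, ← h4, ← zpow_add₀ (q_ne_zero r)]
    refine q_zpow_congr r ⟨σ * x, ?_⟩
    rw [hP]
    push_cast
    ring
  simp only [h3, Finset.sum_neg_distrib] at h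
  rw [gaussianCoeff, neg_eq_self.1 h, mul_zero]

/-- At even exponents the square is completed over the integers, with no inverse of 2. -/
theorem gaussianCoeff_two_mul {σ : ℤ} (hσ : σ * σ = 1) (e : ℤ) :
    gaussianCoeff r σ (2 * e) = 1 / (r₁ r : ℂ) *
      (∑ c ∈ Finset.range (r₁ r), q r ^ (2 * σ * (c : ℤ) ^ 2)) * q r ^ (-(2 * σ) * e ^ 2) := by
  rw [gaussianCoeff, mul_assoc, Finset.sum_mul,
    ← sum_range_periodic_add (N := r₁ r)
      (g := fun x => q r ^ (2 * σ * x ^ 2) * q r ^ (-(2 * σ) * e ^ 2)) (fun x => by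
      rw [q_zpow_congr r (m := 2 * σ * (x + r₁ r) ^ 2) (n := 2 * σ * x ^ 2)
        ⟨σ * (2 * x + r₁ r), by ring⟩]) (-(σ * e))]
  congr 1
  refine Finset.sum_congr rfl fun c _ => ?_
  rw [← zpow_add₀ (q_ne_zero r)]
  congr 1
  linear_combination (-(2 * σ * e ^ 2) + 4 * c * e) * hσ

/-- For odd `d` the summand has period `M`, which is odd, so odd values of `c` contribute as much as
even ones. The sum over even `c` has its square completed with `h²`, an inverse of 4 modulo `M`. -/
theorem gaussianCoeff_of_two_mul_odd {M : ℕ} {h : ℤ} (hM : r₁ r = 2 * M) (hh : (M : ℤ) = 2 * h - 1)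
    {σ : ℤ} (hσ : σ * σ = 1) {d : ℤ} (hd : Odd d) :
    gaussianCoeff r σ d = 1 / (M : ℂ) *
      (∑ c ∈ Finset.range M, q r ^ (8 * σ * (c : ℤ) ^ 2)) * q r ^ (-(4 * σ * h ^ 3) * d ^ 2) := by
  have hσd : Even (σ * M - d) := by
    have h1 : Odd (σ * σ) := by rw [hσ]; exact odd_one
    have h2 : Odd (M : ℤ) := ⟨h - 1, by rw [hh]; ring⟩
    exact ((Int.odd_mul.1 h1).1.mul h2).sub_odd hd
  have hper : ∀ x : ℤ, q r ^ (2 * σ * (x + M) ^ 2 - 2 * (x + M) * d) =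
      q r ^ (2 * σ * x ^ 2 - 2 * x * d) := by
    intro x
    obtain ⟨y, hy⟩ := hσd
    refine q_zpow_congr r ⟨σ * x + y, ?_⟩
    rw [hM]
    push_cast
    linear_combination 2 * M * hy
  have hodd : ∑ c ∈ Finset.range M, q r ^ (2 * σ * ((2 * c + 1 : ℕ) : ℤ) ^ 2 -
      2 * ((2 * c + 1 : ℕ) : ℤ) * d) =
      ∑ c ∈ Finset.range M, q r ^ (2 * σ * ((2 * c : ℕ) : ℤ) ^ 2 - 2 * ((2 * c : ℕ) : ℤ) * d) := by
    have := sum_range_periodic_add (N := M)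
      (g := fun x => q r ^ (2 * σ * (2 * x) ^ 2 - 2 * (2 * x) * d)) (fun x => by
        rw [mul_add, two_mul (M : ℤ), ← add_assoc, hper, hper]) h
    push_cast
    rw [← this]
    refine Finset.sum_congr rfl fun c _ => ?_
    rw [← hper, show (2 * (c : ℤ) + 1 + M) = 2 * (c + h) by rw [hh]; ring]
  have hc : 1 / (r₁ r : ℂ) * 2 = 1 / M := by
    have : (M : ℂ) ≠ 0 := by
      have := r₁_pos r
      exact_mod_cast (by omega : M ≠ 0)
    rw [hM]; push_cast; field_simp
  rw [gaussianCoeff, hM, sum_range_two_mul, hodd, ← two_mul, ← mul_assoc, ← hM, hc, mul_assoc,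
    Finset.sum_mul, ← sum_range_periodic_add (N := M)
      (g := fun x => q r ^ (8 * σ * x ^ 2) * q r ^ (-(4 * σ * h ^ 3) * d ^ 2)) (fun x => by
      rw [q_zpow_congr r (m := 8 * σ * (x + M) ^ 2) (n := 8 * σ * x ^ 2)
        ⟨2 * σ * (2 * x + M), by rw [hM]; push_cast; ring⟩]) (-(σ * h ^ 2 * d))]
  congr 1
  refine Finset.sum_congr rfl fun c _ => ?_
  rw [← zpow_add₀ (q_ne_zero r)]
  -- Modulo `2r' = 4M` one has `16h² ≡ 4` from `4h² - 1 = M (2h + 1)`, and `8h⁴ ≡ 4h³` from `2h = M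
  -- + 1`.
  refine q_zpow_congr r ⟨c * d * (2 * h + 1) - σ * h ^ 3 * d ^ 2, ?_⟩
  rw [hM]
  push_cast
  rw [hh]
  linear_combination (-(8 * σ * h ^ 4 * d ^ 2) + 16 * c * h ^ 2 * d) * hσ

end

section

variable (r : ℕ) [Fact (2 < r)]

theorem gaussian_of_odd {h : ℤ} (hh : (r₁ r : ℤ) = 2 * h - 1) {σ : ℤ} (hσ : σ * σ = 1) (m : ℤ) {z : ℂ}
    (hz : ∑ c ∈ Finset.range (r₁ r), q r ^ (2 * σ * (c : ℤ) ^ 2) = √(r₁ r : ℝ) * z) :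
    gaussian r σ = (z / √(r₁ r : ℝ)) • ∑ b ∈ Finset.range (r₁ r),
      q r ^ (-(2 * σ * h ^ 2) * ((b : ℤ) + m) ^ 2) • Kpow r (b + m) := by
  rw [gaussian_eq_sum_add r σ m, Finset.smul_sum]
  refine Finset.sum_congr rfl fun b _ => ?_
  rw [gaussianCoeff_of_odd r hh hσ, hz, sqrt_mul_div_self (r₁_pos r), smul_smul]

theorem gaussian_of_two_mul_odd {M : ℕ} {h : ℤ} (hM : r₁ r = 2 * M) (hh : (M : ℤ) = 2 * h - 1)
    {σ : ℤ} (hσ : σ * σ = 1) {m : ℤ} (hm : Odd m) {z : ℂ}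
    (hz : ∑ c ∈ Finset.range M, q r ^ (8 * σ * (c : ℤ) ^ 2) = √(M : ℝ) * z) :
    gaussian r σ = (z / √(M : ℝ)) • ∑ b ∈ Finset.range M,
      q r ^ (-(4 * σ * h ^ 3) * (2 * (b : ℤ) + m) ^ 2) • Kpow r (2 * b + m) := by
  have hM0 : 0 < M := by have := r₁_pos r; omega
  have hσo : Odd (σ * M) := by
    have h1 : Odd (σ * σ) := by rw [hσ]; exact odd_one
    exact (Int.odd_mul.1 h1).1.mul ⟨h - 1, by rw [hh]; ring⟩
  rw [gaussian_eq_sum_add r σ m, hM, sum_range_two_mul, Finset.smul_sum]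
  rw [Finset.sum_eq_zero (s := Finset.range M)
    (f := fun i => gaussianCoeff r σ (((2 * i + 1 : ℕ) : ℤ) + m) • Kpow r (((2 * i + 1 : ℕ) : ℤ) + m)),
    add_zero]
  · refine Finset.sum_congr rfl fun b _ => ?_
    rw [gaussianCoeff_of_two_mul_odd r hM hh hσ, hz, sqrt_mul_div_self hM0, smul_smul]
    · push_cast; rfl
    · push_cast
      exact (even_two_mul _).add_odd hm
  · intro b _
    rw [gaussianCoeff_eq_zero r hM, zero_smul]
    refine hσo.sub_even ?_
    push_cast
    exact ((even_two_mul _).add_one).add_odd hm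

theorem gaussian_of_four_dvd {P : ℕ} (hP : r₁ r = 2 * P) (hPe : Even P) {σ : ℤ} (hσ : σ * σ = 1)
    {z : ℂ} (hz : ∑ c ∈ Finset.range (r₁ r), q r ^ (2 * σ * (c : ℤ) ^ 2) = √(r₁ r : ℝ) * z) :
    gaussian r σ = (z / √(r₁ r : ℝ)) • ∑ e ∈ Finset.range P,
      q r ^ (-(2 * σ) * (e : ℤ) ^ 2) • Kpow r (2 * e) := by
  have hcoeff := fun e => gaussianCoeff_two_mul r hσ e
  simp only [hz, sqrt_mul_div_self (r₁_pos r)] at hcoeff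
  rw [gaussian_eq_sum r σ, Finset.smul_sum]
  nth_rewrite 1 [hP]
  rw [sum_range_two_mul]
  rw [Finset.sum_eq_zero (s := Finset.range P)
    (f := fun i => gaussianCoeff r σ ((2 * i + 1 : ℕ) : ℤ) • Kpow r ((2 * i + 1 : ℕ) : ℤ)), add_zero]
  · refine Finset.sum_congr rfl fun b _ => ?_
    push_cast
    rw [hcoeff, smul_smul]
  · intro b _
    rw [gaussianCoeff_eq_zero r hP, zero_smul]
    push_cast
    exact Even.sub_odd (((Int.even_coe_nat P).2 hPe).mul_left σ) (even_two_mul _).add_one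

end

/-! ### Expansions of the ribbon element -/

theorem ribbonPos_eq_of_gaussian (r : ℕ) {ι : Type*} (s : Finset ι) (f g : ι → ℤ) (z : ℂ)
    (h : gaussian r (-1) = z • ∑ i ∈ s, q r ^ f i • Kpow r (g i)) :
    ribbonPos r = z • ∑ a ∈ Finset.range (r₁ r), ∑ i ∈ s,
      (brace r (-1) ^ a / qFact r a * q r ^ (-(((a : ℤ) + 3) * a / 2) + f i)) •
        (F r ^ a * E r ^ a * Kpow r (-a - 1 + g i)) := by
  rw [ribbonPos, Finset.smul_sum, h]
  refine Finset.sum_congr rfl fun a _ => ?_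
  simp only [mul_smul_comm, Finset.mul_sum, Finset.smul_sum, smul_smul, Kpow_mul, coeffPos]
  refine Finset.sum_congr rfl fun i _ => ?_
  rw [zpow_add₀ (q_ne_zero r)]
  congr 1
  ring

theorem ribbonNeg_eq_of_gaussian (r : ℕ) {ι : Type*} (s : Finset ι) (f g : ι → ℤ) (z : ℂ)
    (h : gaussian r 1 = z • ∑ i ∈ s, q r ^ f i • Kpow r (g i)) :
    ribbonNeg r = z • ∑ a ∈ Finset.range (r₁ r), ∑ i ∈ s,
      (brace r 1 ^ a / qFact r a * q r ^ (((a : ℤ) + 3) * a / 2 + f i)) •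
        (F r ^ a * E r ^ a * Kpow r (a + 1 + g i)) := by
  rw [ribbonNeg, Finset.smul_sum, h]
  refine Finset.sum_congr rfl fun a _ => ?_
  simp only [mul_smul_comm, Finset.mul_sum, Finset.smul_sum, smul_smul, Kpow_mul, coeffNeg]
  refine Finset.sum_congr rfl fun i _ => ?_
  rw [zpow_add₀ (q_ne_zero r)]
  congr 1
  ring

/-! ### The relevant Gauss sums written in powers of `q`. -/

theorem r₁_of_odd {r : ℕ} (h : r % 2 = 1) : r₁ r = r := by
  have : Nat.gcd r 2 = 1 := Nat.coprime_two_right.2 (Nat.odd_iff.2 h)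
  rw [r₁, this, Nat.div_one]

theorem r₁_of_even {r : ℕ} (h : r % 2 = 0) : r = 2 * r₁ r := by
  have : Nat.gcd r 2 = 2 := Nat.gcd_eq_right (by omega)
  rw [r₁, this]
  omega

theorem r₂_of_four_dvd {r : ℕ} (h : r % 4 = 0) : r = 4 * r₂ r := by
  have : Nat.gcd r 4 = 4 := Nat.gcd_eq_right (by omega)
  rw [r₂, this]
  omega

theorem sum_q_of_odd {r : ℕ} (h : r % 2 = 1) :
    ∑ c ∈ Finset.range r, q r ^ (2 * (c : ℤ) ^ 2) =
      √(r : ℝ) * Complex.I ^ (-(((r : ℤ) - 1) / 2)) := by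
  rw [← GaussSum.sum_exp_two_mul_sq_of_odd (Nat.odd_iff.2 h)]
  refine Finset.sum_congr rfl fun c _ => ?_
  rw [q_zpow_eq_exp]
  push_cast
  rfl

theorem sum_q_of_even {r : ℕ} (h : r % 2 = 0) :
    ∑ c ∈ Finset.range (r₁ r), q r ^ (2 * (c : ℤ) ^ 2) =
      ∑ c ∈ Finset.range (r₁ r), Complex.exp (2 * Real.pi * Complex.I * c ^ 2 / (r₁ r)) := by
  refine Finset.sum_congr rfl fun c _ => ?_
  have h1 : (r : ℂ) = 2 * r₁ r := by exact_mod_cast r₁_of_even h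
  rw [q_zpow_eq_exp, h1, show 2 * Real.pi * Complex.I * ((2 * (c : ℤ) ^ 2 : ℤ) : ℂ) =
    2 * (2 * Real.pi * Complex.I * c ^ 2) by push_cast; ring, mul_div_mul_left _ _ two_ne_zero]

theorem sum_q_of_mod_eight {r : ℕ} (h : r % 8 = 4) :
    ∑ c ∈ Finset.range (r₂ r), q r ^ (8 * (c : ℤ) ^ 2) =
      √(r₂ r : ℝ) * Complex.I ^ (-(((r₂ r : ℤ) - 1) / 2)) := by
  have h0 : r = 4 * r₂ r := r₂_of_four_dvd (by omega)
  rw [← GaussSum.sum_exp_two_mul_sq_of_odd (Nat.odd_iff.2 (by omega))]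
  refine Finset.sum_congr rfl fun c _ => ?_
  have h1 : (r : ℂ) = 4 * r₂ r := by exact_mod_cast h0
  rw [q_zpow_eq_exp, h1, show 2 * Real.pi * Complex.I * ((8 * (c : ℤ) ^ 2 : ℤ) : ℂ) =
    4 * (2 * Real.pi * Complex.I * (2 * c ^ 2)) by push_cast; ring, mul_div_mul_left _ _ (by norm_num)]

/-! ### The four residue cases. -/

section

variable {r : ℕ} [Fact (2 < r)]

theorem ribbon_of_odd (h : r % 2 = 1) :
    ribbonPos r = (Complex.I ^ (((r : ℤ) - 1) / 2) / (√(r : ℝ) : ℂ)) •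
      ∑ a ∈ Finset.range r, ∑ b ∈ Finset.range r,
        (brace r (-1) ^ a / qFact r a *
          q r ^ (-(((a : ℤ) + 3) * a / 2) + ((r : ℤ) + 1) / 2 * ((b : ℤ) + 1) ^ 2)) •
          (F r ^ a * E r ^ a * Kpow r (-(a : ℤ) + b)) ∧
    ribbonNeg r = (Complex.I ^ (-(((r : ℤ) - 1) / 2)) / (√(r : ℝ) : ℂ)) •
      ∑ a ∈ Finset.range r, ∑ b ∈ Finset.range r,
        (brace r 1 ^ a / qFact r a *
          q r ^ (((a : ℤ) + 3) * a / 2 - ((r : ℤ) + 1) / 2 * ((b : ℤ) - 1) ^ 2)) •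
          (F r ^ a * E r ^ a * Kpow r ((a : ℤ) + b)) := by
  have h1 := r₁_of_odd h
  obtain ⟨t, ht⟩ : ∃ t : ℤ, t = ((r : ℤ) + 1) / 2 := ⟨_, rfl⟩
  have ht2 : (r : ℤ) = 2 * t - 1 := by omega
  have hz := sum_q_of_odd h
  have hz' := sum_q_zpow_neg hz
  rw [conj_I_zpow, neg_neg] at hz'
  -- The window of summation is shifted by 1, and by -1 for the inverse, to absorb the factor
  -- `K^(-1)`, respectively `K`, in the closed form.
  have hp := ribbonPos_eq_of_gaussian r _ _ _ _ (gaussian_of_odd r (h := t) (by rw [h1, ht2])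
    (σ := -1) (by norm_num) 1 (by rw [h1]; exact hz'))
  have hn := ribbonNeg_eq_of_gaussian r _ _ _ _ (gaussian_of_odd r (h := t) (by rw [h1, ht2])
    (σ := 1) (by norm_num) (-1) (by rw [h1]; exact hz))
  rw [h1] at hp hn
  rw [← ht]
  constructor
  · rw [hp]
    congr 1
    refine Finset.sum_congr rfl fun a _ => Finset.sum_congr rfl fun b _ => ?_
    congr 2
    -- The exponents `2t²` and `t` differ by `t (2t - 1) = t r`, so `q^r = 1` is needed here.
    · refine q_zpow_eq_of_dvd r ⟨t * (b + 1) ^ 2, ?_⟩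
      rw [ht2]
      ring
    · congr 1
      ring
  · rw [hn]
    congr 1
    refine Finset.sum_congr rfl fun a _ => Finset.sum_congr rfl fun b _ => ?_
    congr 2
    · refine q_zpow_eq_of_dvd r ⟨-(t * (b - 1) ^ 2), ?_⟩
      rw [ht2]
      ring
    · congr 1
      ring

theorem ribbon_of_mod_four (h : r % 4 = 2) :
    ribbonPos r = ((jacobiSym 2 (r₁ r) : ℂ) *
        (Complex.I ^ (((r₁ r : ℤ) - 1) / 2) / (√(r₁ r : ℝ) : ℂ))) •
      ∑ a ∈ Finset.range (r₁ r), ∑ b ∈ Finset.range (r₁ r),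
        (brace r (-1) ^ a / qFact r a *
          q r ^ (-(((a : ℤ) + 3) * a / 2)
            + ((r₁ r : ℤ) + 1) ^ 2 / 2 * ((b : ℤ) + 1) ^ 2)) •
          (F r ^ a * E r ^ a * Kpow r (-(a : ℤ) + b)) ∧
    ribbonNeg r = ((jacobiSym 2 (r₁ r) : ℂ) *
        (Complex.I ^ (-(((r₁ r : ℤ) - 1) / 2)) / (√(r₁ r : ℝ) : ℂ))) •
      ∑ a ∈ Finset.range (r₁ r), ∑ b ∈ Finset.range (r₁ r),
        (brace r 1 ^ a / qFact r a *
          q r ^ (((a : ℤ) + 3) * a / 2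
            - ((r₁ r : ℤ) + 1) ^ 2 / 2 * ((b : ℤ) - 1) ^ 2)) •
          (F r ^ a * E r ^ a * Kpow r ((a : ℤ) + b)) := by
  have h1 : r = 2 * r₁ r := r₁_of_even (by omega)
  obtain ⟨t, ht2⟩ : ∃ t : ℤ, (r₁ r : ℤ) = 2 * t - 1 := ⟨((r₁ r : ℤ) + 1) / 2, by omega⟩
  have ht : ((r₁ r : ℤ) + 1) ^ 2 / 2 = 2 * t ^ 2 := by
    rw [ht2, show (2 * t - 1 + 1) ^ 2 = 2 * (2 * t ^ 2) by ring]
    exact Int.mul_ediv_cancel_left _ two_ne_zero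
  have hz := sum_q_of_even (r := r) (by omega)
  rw [GaussSum.sum_exp_sq_of_odd (Nat.odd_iff.2 (by omega))] at hz
  have hz' := sum_q_zpow_neg hz
  rw [map_mul, conj_I_zpow, neg_neg, map_intCast] at hz'
  have hp := ribbonPos_eq_of_gaussian r _ _ _ _ (gaussian_of_odd r (h := t) ht2
    (σ := -1) (by norm_num) 1 hz')
  have hn := ribbonNeg_eq_of_gaussian r _ _ _ _ (gaussian_of_odd r (h := t) ht2
    (σ := 1) (by norm_num) (-1) hz)
  rw [ht, mul_div_assoc', mul_div_assoc']
  constructor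
  · rw [hp]
    congr 1
    refine Finset.sum_congr rfl fun a _ => Finset.sum_congr rfl fun b _ => ?_
    congr 3 <;> ring
  · rw [hn]
    congr 1
    refine Finset.sum_congr rfl fun a _ => Finset.sum_congr rfl fun b _ => ?_
    congr 3 <;> ring

theorem ribbon_of_mod_eight (h : r % 8 = 4) :
    ribbonPos r = (Complex.I ^ (((r₂ r : ℤ) - 1) / 2) / (√(r₂ r : ℝ) : ℂ)) •
      ∑ a ∈ Finset.range (r₁ r), ∑ b ∈ Finset.range (r₂ r),
        (brace r (-1) ^ a / qFact r a *
          q r ^ (-(((a : ℤ) + 3) * a / 2)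
            + ((r₂ r : ℤ) + 1) ^ 3 / 2 * (2 * (b : ℤ) + 1) ^ 2)) •
          (F r ^ a * E r ^ a * Kpow r (-(a : ℤ) + 2 * b)) ∧
    ribbonNeg r = (Complex.I ^ (-(((r₂ r : ℤ) - 1) / 2)) / (√(r₂ r : ℝ) : ℂ)) •
      ∑ a ∈ Finset.range (r₁ r), ∑ b ∈ Finset.range (r₂ r),
        (brace r 1 ^ a / qFact r a *
          q r ^ (((a : ℤ) + 3) * a / 2
            - ((r₂ r : ℤ) + 1) ^ 3 / 2 * (2 * (b : ℤ) - 1) ^ 2)) •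
          (F r ^ a * E r ^ a * Kpow r ((a : ℤ) + 2 * b)) := by
  have h1 : r = 2 * r₁ r := r₁_of_even (by omega)
  have h2 : r = 4 * r₂ r := r₂_of_four_dvd (by omega)
  have h12 : r₁ r = 2 * r₂ r := by omega
  obtain ⟨t, ht2⟩ : ∃ t : ℤ, (r₂ r : ℤ) = 2 * t - 1 := ⟨((r₂ r : ℤ) + 1) / 2, by omega⟩
  have ht : ((r₂ r : ℤ) + 1) ^ 3 / 2 = 4 * t ^ 3 := by
    rw [ht2, show (2 * t - 1 + 1) ^ 3 = 2 * (4 * t ^ 3) by ring]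
    exact Int.mul_ediv_cancel_left _ two_ne_zero
  have hz := sum_q_of_mod_eight h
  have hz' := sum_q_zpow_neg hz
  rw [conj_I_zpow, neg_neg] at hz'
  have hp := ribbonPos_eq_of_gaussian r _ _ _ _ (gaussian_of_two_mul_odd r h12 ht2
    (σ := -1) (by norm_num) (m := 1) odd_one hz')
  have hn := ribbonNeg_eq_of_gaussian r _ _ _ _ (gaussian_of_two_mul_odd r h12 ht2
    (σ := 1) (by norm_num) (m := -1) (by decide) hz)
  rw [ht]
  constructor
  · rw [hp]
    congr 1
    refine Finset.sum_congr rfl fun a _ => Finset.sum_congr rfl fun b _ => ?_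
    congr 3 <;> ring
  · rw [hn]
    congr 1
    refine Finset.sum_congr rfl fun a _ => Finset.sum_congr rfl fun b _ => ?_
    congr 3 <;> ring

theorem ribbon_of_eight_dvd {k s ψ : ℕ} (hk : 3 ≤ k) (hr : r = 2 ^ k * s)
    (hψ : s * ψ ≡ 1 [MOD 2 ^ (k - 1)]) (hs : Odd s) :
    ribbonPos r = ((1 - Complex.I) / ((√2 : ℝ) * (√(r₂ r : ℝ) : ℝ) : ℂ)) •
      ∑ a ∈ Finset.range (r₁ r), ∑ b ∈ Finset.range s, ∑ m ∈ Finset.range (2 ^ (k - 2)),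
        (brace r (-1) ^ a / qFact r a *
          q r ^ (-(((a : ℤ) + 3) * a / 2)
            + 2 * ((s : ℤ) * ψ + ((s : ℤ) + 1) ^ (k + 1)) * (2 ^ (k - 2) * (b : ℤ) + m) ^ 2)) •
          (F r ^ a * E r ^ a * Kpow r (-(a : ℤ) + 2 ^ (k - 1) * b + 2 * m - 1)) ∧
    ribbonNeg r = ((1 + Complex.I) / ((√2 : ℝ) * (√(r₂ r : ℝ) : ℝ) : ℂ)) •
      ∑ a ∈ Finset.range (r₁ r), ∑ b ∈ Finset.range s, ∑ m ∈ Finset.range (2 ^ (k - 2)),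
        (brace r 1 ^ a / qFact r a *
          q r ^ (((a : ℤ) + 3) * a / 2
            - 2 * ((s : ℤ) * ψ + ((s : ℤ) + 1) ^ (k + 1)) * (2 ^ (k - 2) * (b : ℤ) + m) ^ 2)) •
          (F r ^ a * E r ^ a * Kpow r ((a : ℤ) + 2 ^ (k - 1) * b + 2 * m + 1)) := by
  obtain ⟨j, rfl⟩ : ∃ j, k = j + 3 := ⟨k - 3, by omega⟩
  rw [show j + 3 - 1 = j + 2 by omega] at hψ
  rw [show j + 3 - 1 = j + 2 by omega, show j + 3 - 2 = j + 1 by omega]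
  have h8 : r = 8 * (2 ^ j * s) := by rw [hr]; ring
  have h1 : r = 2 * r₁ r := r₁_of_even (by omega)
  have h2 : r = 4 * r₂ r := r₂_of_four_dvd (by omega)
  have h12 : r₁ r = 2 * r₂ r := by omega
  have h2' : r₂ r = 2 ^ (j + 1) * s := by rw [pow_succ, mul_right_comm]; omega
  have hz := sum_q_of_even (r := r) (by omega)
  rw [GaussSum.sum_exp_sq_of_four_dvd (r₁_pos r) (by omega)] at hz
  have hz' := sum_q_zpow_neg hz
  rw [map_add, map_one, Complex.conj_I, ← sub_eq_add_neg] at hz'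
  have hp := ribbonPos_eq_of_gaussian r _ _ _ _ (gaussian_of_four_dvd r h12
    (Nat.even_iff.2 (by omega)) (σ := -1) (by norm_num) hz')
  have hn := ribbonNeg_eq_of_gaussian r _ _ _ _ (gaussian_of_four_dvd r h12
    (Nat.even_iff.2 (by omega)) (σ := 1) (by norm_num) hz)
  have hsqrt : (√(r₁ r : ℝ) : ℂ) = (√2 : ℝ) * (√(r₂ r : ℝ) : ℝ) := by
    rw [h12, Nat.cast_mul, Nat.cast_ofNat, Real.sqrt_mul (by norm_num), Complex.ofReal_mul]
  -- The constant `sψ + (s+1)^(k+1)` is 1 modulo `r' = 2^(k-1) s` by the Chinese remainder theorem.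
  -- Modulo `2^(k-1)` the first summand is 1 and the second is 0 since `s + 1` is even; modulo `s`
  -- the roles are exchanged. It can thus be replaced by 1 in the exponent.
  have hdvd : (r₁ r : ℤ) ∣ (s : ℤ) * ψ + ((s : ℤ) + 1) ^ (j + 3 + 1) - 1 := by
    have e1 : (r₁ r : ℤ) = 2 ^ (j + 2) * s := by
      rw [h12, h2']; push_cast; ring
    have e2 : IsCoprime ((2 : ℤ) ^ (j + 2)) s := by
      refine IsCoprime.pow_left ?_
      exact_mod_cast Nat.isCoprime_iff_coprime.2 (Nat.coprime_two_left.2 hs)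
    rw [e1]
    refine e2.mul_dvd ?_ ?_
    · have e3 : (2 : ℤ) ^ (j + 2) ∣ (s : ℤ) * ψ - 1 := by
        have := (Nat.modEq_iff_dvd.1 hψ.symm)
        exact_mod_cast this
      have e4 : (2 : ℤ) ^ (j + 2) ∣ ((s : ℤ) + 1) ^ (j + 3 + 1) := by
        have e5 : (2 : ℤ) ∣ (s : ℤ) + 1 := by
          obtain ⟨i, hi⟩ := hs
          exact ⟨i + 1, by rw [hi]; push_cast; ring⟩
        exact (pow_dvd_pow 2 (by omega)).trans (pow_dvd_pow_of_dvd e5 _)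
      rw [show (s : ℤ) * ψ + ((s : ℤ) + 1) ^ (j + 3 + 1) - 1 =
        (s * ψ - 1) + ((s : ℤ) + 1) ^ (j + 3 + 1) by ring]
      exact dvd_add e3 e4
    · have e6 : (s : ℤ) ∣ ((s : ℤ) + 1) ^ (j + 3 + 1) - 1 := by
        have := sub_dvd_pow_sub_pow ((s : ℤ) + 1) 1 (j + 3 + 1)
        rwa [add_sub_cancel_right, one_pow] at this
      rw [add_sub_assoc]
      exact dvd_add (dvd_mul_right _ _) e6
  obtain ⟨y, hy⟩ := hdvd
  rw [← hsqrt]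
  constructor
  · rw [hp]
    congr 1
    refine Finset.sum_congr rfl fun a _ => ?_
    -- The single index `e < r''` is written as `2^(k-2) b + m`.
    rw [h2', sum_range_mul]
    refine Finset.sum_congr rfl fun b _ => Finset.sum_congr rfl fun m _ => ?_
    push_cast
    congr 2
    · refine q_zpow_congr r ⟨-y * (2 ^ (j + 1) * (b : ℤ) + m) ^ 2, ?_⟩
      linear_combination (-2 * (2 ^ (j + 1) * (b : ℤ) + m) ^ 2) * hy
    · congr 1
      ring
  · rw [hn]
    congr 1
    refine Finset.sum_congr rfl fun a _ => ?_
    rw [h2', sum_range_mul]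
    refine Finset.sum_congr rfl fun b _ => Finset.sum_congr rfl fun m _ => ?_
    push_cast
    congr 2
    · refine q_zpow_congr r ⟨y * (2 ^ (j + 1) * (b : ℤ) + m) ^ 2, ?_⟩
      linear_combination (2 * (2 ^ (j + 1) * (b : ℤ) + m) ^ 2) * hy
    · congr 1
      ring

variable (r) in
/-- The ribbon element as a unit. -/
def ribbonUnit : (SmallQuantumSl2 r)ˣ :=
  ⟨ribbonPos r, ribbonNeg r, ribbonPos_mul_ribbonNeg r,
    (commute_ribbonPos_ribbonNeg r).symm.eq.trans (ribbonPos_mul_ribbonNeg r)⟩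

end

end SmallQuantum

end

open SmallQuantum in
theorem lemmaL (r : ℕ) [Fact (2 < r)] :
    ∃ v : (SmallQuantumSl2 r)ˣ, (v : SmallQuantumSl2 r) = ribbonElement r ∧
      (r % 2 = 1 →
        (v : SmallQuantumSl2 r) =
          (Complex.I ^ (((r : ℤ) - 1) / 2) / (√(r : ℝ) : ℂ)) •
            ∑ a ∈ Finset.range r, ∑ b ∈ Finset.range r,
              (brace r (-1) ^ a / qFact r a *
                q r ^ (-(((a : ℤ) + 3) * a / 2) + ((r : ℤ) + 1) / 2 * ((b : ℤ) + 1) ^ 2)) •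
                (F r ^ a * E r ^ a * (K r ^ (-(a : ℤ) + b) : (SmallQuantumSl2 r)ˣ)) ∧
        ((v⁻¹ : (SmallQuantumSl2 r)ˣ) : SmallQuantumSl2 r) =
          (Complex.I ^ (-(((r : ℤ) - 1) / 2)) / (√(r : ℝ) : ℂ)) •
            ∑ a ∈ Finset.range r, ∑ b ∈ Finset.range r,
              (brace r 1 ^ a / qFact r a *
                q r ^ (((a : ℤ) + 3) * a / 2 - ((r : ℤ) + 1) / 2 * ((b : ℤ) - 1) ^ 2)) •
                (F r ^ a * E r ^ a * (K r ^ ((a : ℤ) + b) : (SmallQuantumSl2 r)ˣ))) ∧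
      (r % 4 = 2 →
        (v : SmallQuantumSl2 r) =
          ((jacobiSym 2 (r₁ r) : ℂ) *
              (Complex.I ^ (((r₁ r : ℤ) - 1) / 2) / (√(r₁ r : ℝ) : ℂ))) •
            ∑ a ∈ Finset.range (r₁ r), ∑ b ∈ Finset.range (r₁ r),
              (brace r (-1) ^ a / qFact r a *
                q r ^ (-(((a : ℤ) + 3) * a / 2)
                  + ((r₁ r : ℤ) + 1) ^ 2 / 2 * ((b : ℤ) + 1) ^ 2)) •
                (F r ^ a * E r ^ a * (K r ^ (-(a : ℤ) + b) : (SmallQuantumSl2 r)ˣ)) ∧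
        ((v⁻¹ : (SmallQuantumSl2 r)ˣ) : SmallQuantumSl2 r) =
          ((jacobiSym 2 (r₁ r) : ℂ) *
              (Complex.I ^ (-(((r₁ r : ℤ) - 1) / 2)) / (√(r₁ r : ℝ) : ℂ))) •
            ∑ a ∈ Finset.range (r₁ r), ∑ b ∈ Finset.range (r₁ r),
              (brace r 1 ^ a / qFact r a *
                q r ^ (((a : ℤ) + 3) * a / 2
                  - ((r₁ r : ℤ) + 1) ^ 2 / 2 * ((b : ℤ) - 1) ^ 2)) •
                (F r ^ a * E r ^ a * (K r ^ ((a : ℤ) + b) : (SmallQuantumSl2 r)ˣ))) ∧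
      (r % 8 = 4 →
        (v : SmallQuantumSl2 r) =
          (Complex.I ^ (((r₂ r : ℤ) - 1) / 2) / (√(r₂ r : ℝ) : ℂ)) •
            ∑ a ∈ Finset.range (r₁ r), ∑ b ∈ Finset.range (r₂ r),
              (brace r (-1) ^ a / qFact r a *
                q r ^ (-(((a : ℤ) + 3) * a / 2)
                  + ((r₂ r : ℤ) + 1) ^ 3 / 2 * (2 * (b : ℤ) + 1) ^ 2)) •
                (F r ^ a * E r ^ a * (K r ^ (-(a : ℤ) + 2 * b) : (SmallQuantumSl2 r)ˣ)) ∧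
        ((v⁻¹ : (SmallQuantumSl2 r)ˣ) : SmallQuantumSl2 r) =
          (Complex.I ^ (-(((r₂ r : ℤ) - 1) / 2)) / (√(r₂ r : ℝ) : ℂ)) •
            ∑ a ∈ Finset.range (r₁ r), ∑ b ∈ Finset.range (r₂ r),
              (brace r 1 ^ a / qFact r a *
                q r ^ (((a : ℤ) + 3) * a / 2
                  - ((r₂ r : ℤ) + 1) ^ 3 / 2 * (2 * (b : ℤ) - 1) ^ 2)) •
                (F r ^ a * E r ^ a * (K r ^ ((a : ℤ) + 2 * b) : (SmallQuantumSl2 r)ˣ))) ∧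
      (∀ k s ψ : ℕ, 3 ≤ k → Odd s → r = 2 ^ k * s → s * ψ ≡ 1 [MOD 2 ^ (k - 1)] →
        (v : SmallQuantumSl2 r) =
          ((1 - Complex.I) / ((√2 : ℝ) * (√(r₂ r : ℝ) : ℝ) : ℂ)) •
            ∑ a ∈ Finset.range (r₁ r), ∑ b ∈ Finset.range s, ∑ m ∈ Finset.range (2 ^ (k - 2)),
              (brace r (-1) ^ a / qFact r a *
                q r ^ (-(((a : ℤ) + 3) * a / 2)
                  + 2 * ((s : ℤ) * ψ + ((s : ℤ) + 1) ^ (k + 1))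
                    * (2 ^ (k - 2) * (b : ℤ) + m) ^ 2)) •
                (F r ^ a * E r ^ a *
                  (K r ^ (-(a : ℤ) + 2 ^ (k - 1) * b + 2 * m - 1) : (SmallQuantumSl2 r)ˣ)) ∧
        ((v⁻¹ : (SmallQuantumSl2 r)ˣ) : SmallQuantumSl2 r) =
          ((1 + Complex.I) / ((√2 : ℝ) * (√(r₂ r : ℝ) : ℝ) : ℂ)) •
            ∑ a ∈ Finset.range (r₁ r), ∑ b ∈ Finset.range s, ∑ m ∈ Finset.range (2 ^ (k - 2)),
              (brace r 1 ^ a / qFact r a *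
                q r ^ (((a : ℤ) + 3) * a / 2
                  - 2 * ((s : ℤ) * ψ + ((s : ℤ) + 1) ^ (k + 1))
                    * (2 ^ (k - 2) * (b : ℤ) + m) ^ 2)) •
                (F r ^ a * E r ^ a *
                  (K r ^ ((a : ℤ) + 2 ^ (k - 1) * b + 2 * m + 1) : (SmallQuantumSl2 r)ˣ))) := by
  -- The inverse of `ribbonUnit r` is `ribbonNeg r` and `Kpow r m` is the coerced unit power `K r ^
  -- m`, both by definition, so the closed forms apply verbatim.
  exact ⟨ribbonUnit r, (ribbonElement_eq r).symm, fun h => ribbon_of_odd h,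
    fun h => ribbon_of_mod_four h, fun h => ribbon_of_mod_eight h,
    fun _ _ _ hk hs hr hψ => ribbon_of_eight_dvd hk hr hψ hs⟩
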